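/- All graphs are finite and simple. A graph is *chordal* if it has no induced cycle of length more than three; it is *strongly chordal* if it is chordal and every cycle $[x_1,\ldots,x_{2m}]$ of even length $2m\ge 6$ has an odd chord, that is, an edge $\{x_i,x_j\}$ joining two vertices of the cycle whose distance in the cycle is odd and greater than one. For an integer $k\ge 0$, a *$k$-tree* is a connected chordal graph which is either a $k$-clique or in which every maximal clique has cardinality $k+1$. A *black-and-white coloring* of $G$ with $b$ black and $w$ white vertices consists of disjoint vertex sets $B$ and $W$ with $|B|=b$ and $|W|=w$ such that no vertex of $B$ is adjacent to a vertex of $W$; the *black-and-white coloring problem* asks, given $G$, $b$ and $w$, whether one exists. **Theorem.** There is a polynomial-time algorithm that solves the black-and-white coloring problem on strongly chordal $k$-trees. Precisely: there are a single random access machine program (unit cost; addition, truncated subtraction, zero tests and indirect addressing on natural numbers) and a polynomial $p$ such that for all $n$ and $k$, every strongly chordal $k$-tree $G$ with vertex set $\{0,\ldots,n-1\}$ (given by $n$ and its adjacency matrix; $k$ is not part of the input), and all integers $b,w\ge 0$, the program halts within $p(n)$ steps and outputs $1$ if $G$ has a black-and-white coloring with $b$ black and $w$ white vertices, and $0$ otherwise.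 In particular $p$ does not depend on $k$, $b$ or $w$. -/

import Mathlib

/-! ## Graph-theoretic notions -/

namespace BW

/-- A graph is chordal if it has no induced cycle of length more than three. -/
def IsChordal {V : Type*} (G : SimpleGraph V) : Prop :=
  ∀ m : ℕ, 4 ≤ m → IsEmpty (SimpleGraph.cycleGraph m ↪g G)

/-- The cycle `c = [x₀, …, x_{ℓ-1}]` has an odd chord: two of its vertices `x_i`, `x_j` are
adjacent in `G` and their distance in the cycle, `min (j - i) (ℓ - (j - i))`, is odd and
greater than one. -/
def HasOddChord {V : Type*} (G : SimpleGraph V) {v : V} (c : G.Walk v v) : Prop :=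
  ∃ i j : ℕ, i < j ∧ j < c.length ∧
    1 < min (j - i) (c.length - (j - i)) ∧ Odd (min (j - i) (c.length - (j - i))) ∧
    G.Adj (c.getVert i) (c.getVert j)

/-- A graph is strongly chordal if it is chordal and each cycle of even length at least six
has an odd chord. -/
def IsStronglyChordal {V : Type*} (G : SimpleGraph V) : Prop :=
  IsChordal G ∧
    ∀ (v : V) (c : G.Walk v v), c.IsCycle → Even c.length → 6 ≤ c.length → HasOddChord G c

/-- A `k`-tree: a connected chordal graph that is either a `k`-clique, or in which every
maximal clique has `k + 1` vertices. -/
def IsKTree {V : Type*} [Fintype V] (G : SimpleGraph V) (k : ℕ) : Prop :=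
  G.Connected ∧ IsChordal G ∧
    (G.IsNClique k Finset.univ ∨
      ∀ K : Finset V, Maximal (fun K' : Finset V => G.IsClique (K' : Set V)) K → K.card = k + 1)

/-- `G` has a black-and-white coloring with `b` black and `w` white vertices. -/
def HasBWColoring {V : Type*} (G : SimpleGraph V) (b w : ℕ) : Prop :=
  ∃ B W : Finset V, Disjoint B W ∧ B.card = b ∧ W.card = w ∧
    ∀ x ∈ B, ∀ y ∈ W, ¬ G.Adj x y

/-! ## Random access machine with a step count

Programs work on registers and on arrays of natural numbers, addressed indirectly.  The only
arithmetic is addition and truncated subtraction, so that one step at most doubles the largest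
number in memory and unit cost is polynomially equivalent to Turing machine time. -/

/-- Contents of the registers and of the arrays. -/
structure State where
  reg : ℕ → ℕ
  arr : ℕ → ℕ → ℕ

/-- Write `x` into register `i`. -/
def State.setReg (s : State) (i x : ℕ) : State :=
  { s with reg := Function.update s.reg i x }

/-- Write `x` into cell `j` of array `a`. -/
def State.setArr (s : State) (a j x : ℕ) : State :=
  { s with arr := Function.update s.arr a (Function.update (s.arr a) j x) }

/-- Expressions: constants, registers, array cells, sums and truncated differences. -/
inductive RExpr where
  | const (c : ℕ)
  | reg (i : ℕ)
  | get (a : ℕ) (e : RExpr)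
  | add (e f : RExpr)
  | sub (e f : RExpr)

/-- Value of an expression in a state. -/
def RExpr.eval (s : State) : RExpr → ℕ
  | .const c => c
  | .reg i => s.reg i
  | .get a e => s.arr a (e.eval s)
  | .add e f => e.eval s + f.eval s
  | .sub e f => e.eval s - f.eval s

/-- Time to evaluate an expression: the number of operations in it. -/
def RExpr.cost : RExpr → ℕ
  | .const _ => 1
  | .reg _ => 1
  | .get _ e => e.cost + 1
  | .add e f => e.cost + f.cost + 1
  | .sub e f => e.cost + f.cost + 1

/-- Programs. The names of the registers and arrays are fixed in the program text; the index
of an array cell is computed. A test succeeds if its value is not zero. -/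
inductive Program where
  | nop
  | assign (i : ℕ) (e : RExpr)
  | store (a : ℕ) (idx e : RExpr)
  | seq (P Q : Program)
  | branch (e : RExpr) (P Q : Program)
  | loop (e : RExpr) (P : Program)

/-- `Exec P s t s'`: started in state `s`, the program `P` halts in state `s'` after exactly
`t` steps. -/
inductive Exec : Program → State → ℕ → State → Prop where
  | nop (s : State) : Exec .nop s 1 s
  | assign (s : State) (i : ℕ) (e : RExpr) :
      Exec (.assign i e) s (e.cost + 1) (s.setReg i (e.eval s))
  | store (s : State) (a : ℕ) (idx e : RExpr) :
      Exec (.store a idx e) s (idx.cost + e.cost + 1) (s.setArr a (idx.eval s) (e.eval s))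
  | seq {P Q : Program} {s s' s'' : State} {t t' : ℕ} :
      Exec P s t s' → Exec Q s' t' s'' → Exec (.seq P Q) s (t + t') s''
  | branch_true {e : RExpr} {P Q : Program} {s s' : State} {t : ℕ} :
      e.eval s ≠ 0 → Exec P s t s' → Exec (.branch e P Q) s (e.cost + 1 + t) s'
  | branch_false {e : RExpr} {P Q : Program} {s s' : State} {t : ℕ} :
      e.eval s = 0 → Exec Q s t s' → Exec (.branch e P Q) s (e.cost + 1 + t) s'
  | loop_true {e : RExpr} {P : Program} {s s' s'' : State} {t t' : ℕ} :
      e.eval s ≠ 0 → Exec P s t s' → Exec (.loop e P) s' t' s'' →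
        Exec (.loop e P) s (e.cost + 1 + t + t') s''
  | loop_false {e : RExpr} {P : Program} {s : State} :
      e.eval s = 0 → Exec (.loop e P) s (e.cost + 1) s

/-- A program has at most one run from a given state. -/
theorem Exec.deterministic {P : Program} {s s₁ s₂ : State} {t₁ t₂ : ℕ}
    (h₁ : Exec P s t₁ s₁) (h₂ : Exec P s t₂ s₂) : t₁ = t₂ ∧ s₁ = s₂ := by
  induction h₁ generalizing t₂ s₂ with
  | nop => cases h₂; exact ⟨rfl, rfl⟩
  | assign => cases h₂; exact ⟨rfl, rfl⟩
  | store => cases h₂; exact ⟨rfl, rfl⟩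
  | seq _ _ ih ih' =>
    cases h₂ with
    | seq a b =>
      obtain ⟨rfl, rfl⟩ := ih a
      obtain ⟨rfl, rfl⟩ := ih' b
      exact ⟨rfl, rfl⟩
  | branch_true h _ ih =>
    cases h₂ with
    | branch_true _ a => obtain ⟨rfl, rfl⟩ := ih a; exact ⟨rfl, rfl⟩
    | branch_false h' _ => exact absurd h' h
  | branch_false h _ ih =>
    cases h₂ with
    | branch_true h' _ => exact absurd h h'
    | branch_false _ a => obtain ⟨rfl, rfl⟩ := ih a; exact ⟨rfl, rfl⟩
  | loop_true h _ _ ih ih' =>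
    cases h₂ with
    | loop_true _ a b =>
      obtain ⟨rfl, rfl⟩ := ih a
      obtain ⟨rfl, rfl⟩ := ih' b
      exact ⟨rfl, rfl⟩
    | loop_false h' => exact absurd h' h
  | loop_false h =>
    cases h₂ with
    | loop_true h' _ _ => exact absurd h h'
    | loop_false _ => exact ⟨rfl, rfl⟩

open Classical in
/-- Input of the black-and-white coloring problem: registers 0, 1, 2 hold the number `n` of
vertices, `b` and `w`; cell `i * n + j` of array 0 holds the entry `(i, j)` of the adjacency
matrix of `G`; everything else is zero. -/
noncomputable def inputState {n : ℕ} (G : SimpleGraph (Fin n)) (b w : ℕ) : State where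
  reg i := if i = 0 then n else if i = 1 then b else if i = 2 then w else 0
  arr a m :=
    if a = 0 ∧ ∃ i j : Fin n, m = (i : ℕ) * n + (j : ℕ) ∧ G.Adj i j then 1 else 0

open Classical in
/-- On input `G`, `b`, `w` the program `P` halts after at most `T` steps, with 1 in register 0
if `G` has a black-and-white coloring with `b` black and `w` white vertices, and with 0 in
register 0 otherwise. -/
def DecidesBWWithin (P : Program) {n : ℕ} (G : SimpleGraph (Fin n)) (b w T : ℕ) : Prop :=
  ∃ (t : ℕ) (s : State), Exec P (inputState G b w) t s ∧ t ≤ T ∧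
    s.reg 0 = if HasBWColoring G b w then 1 else 0

end BW

/-!
A coloring with `b` black and `w` white vertices exists if and only if `w ≤ n` and some set `C` of
at most `n - w` vertices contains the closed neighbourhoods of `b` vertices: take for `C` the
complement of the white set. So the problem is to choose few rows of the closed neighbourhood
matrix such that many columns have all their ones in the chosen rows (`hasBWColoring_iff`).

*Structure.* In a strongly chordal graph, each nonempty set `R` of vertices has a member `v` such
that the closed neighbourhoods containing `v` form a chain on `R`
(`IsStronglyChordal.exists_nest`). For the proof, the rows in `R` and all columns are put in a
doubly lexical order (`exists_doubly_lex`). A submatrix Γ, with rows `1 1` and `1 0`, would grow to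
an ever longer zigzag of incident rows and columns unless the zigzag closes up (`exists_zigzag`),
but a closed zigzag gives an even cycle without odd chord, or, if it meets a vertex both as a row
and as a column, an induced cycle of length more than three (`IsStronglyChordal.not_cyclic`). Hence
the matrix is Γ-free, and its first row is the vertex `v`. Eliminating such vertices one after the
other, and sorting the columns by the binary numbers that they represent, makes the whole matrix
Γ-free (`gammaFree_orderedMatrix`). Unlike a doubly lexical order, this order is computed greedily.

*Dynamic programming.* Let `best M Z t y` be the largest number of columns among the first `t`,
with first row in `Z`, that have all their rows in `Z` among `y` chosen ones. In a Γ-free matrix,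
deciding on the last column `t` splits `best M Z (t + 1) y` into two values for `t`: if its rows in
`Z` are all taken, then so are those of each earlier column that starts in one of them
(`best_succ`). Moreover, two rows are related by `Up M t` if an increasing sequence of rows leads
from one to the other in which consecutive rows share one of the first `t` columns; by Γ-freeness
this is the order of a forest (`Up.comparable`). The trees below different roots have no column in
common, hence their values are combined by max-plus convolution (`best_belowRoots_succ`). The sets
of rows that arise are down-closed in the forest, so the values for the sets `below M n t c`
suffice, and these are polynomially many.

*Machine.* The algorithm is written in a small language with loops, sums, maxima and quantifiers
bounded by the input size, which is translated to machine programs. All programs of this language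
run in polynomial time, by induction on their structure (`exists_program`).
-/

/-! ### A language of bounded loops and its translation -/

namespace BW

/-- Bounded arithmetic terms. Besides constants, the input size, variables, array cells, sums
and truncated differences there are case distinctions, multiplication by the input size, and sums
and maxima over a variable that runs through the numbers below the input size. -/
inductive Term where
  | const (c : ℕ)
  | size
  | var (x : ℕ)
  | get (a : ℕ) (e : Term)
  | add (e f : Term)
  | sub (e f : Term)
  | ite (c e f : Term)
  | scale (e : Term)
  | sum (x : ℕ) (e : Term)
  | sup (x : ℕ) (e : Term)

/-- Value of a term for input size `n`, arrays `A` and values `ρ` of the variables. The condition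
of a case distinction holds if it is not zero. -/
def Term.eval (n : ℕ) (A : ℕ → ℕ → ℕ) : Term → (ℕ → ℕ) → ℕ
  | .const c, _ => c
  | .size, _ => n
  | .var x, ρ => ρ x
  | .get a e, ρ => A a (e.eval n A ρ)
  | .add e f, ρ => e.eval n A ρ + f.eval n A ρ
  | .sub e f, ρ => e.eval n A ρ - f.eval n A ρ
  | .ite c e f, ρ => if c.eval n A ρ ≠ 0 then e.eval n A ρ else f.eval n A ρ
  | .scale e, ρ => n * e.eval n A ρ
  | .sum x e, ρ => ∑ v ∈ Finset.range n, e.eval n A (Function.update ρ x v)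
  | .sup x e, ρ => (Finset.range n).sup fun v => e.eval n A (Function.update ρ x v)

/-- Commands: array assignment, composition, and a loop whose variable runs through the numbers
below the input size. -/
inductive Cmd where
  | store (a : ℕ) (idx e : Term)
  | seq (P Q : Cmd)
  | loop (x : ℕ) (P : Cmd)

/-- The arrays after the first `m` rounds of a loop. -/
def loopRun (f : (ℕ → ℕ) → (ℕ → ℕ → ℕ) → (ℕ → ℕ → ℕ)) (x : ℕ) (ρ : ℕ → ℕ)
    (A : ℕ → ℕ → ℕ) : ℕ → (ℕ → ℕ → ℕ)
  | 0 => A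
  | m + 1 => f (Function.update ρ x m) (loopRun f x ρ A m)

/-- The arrays after a command was run with input size `n`, variables `ρ` and arrays `A`. -/
def Cmd.run (n : ℕ) : Cmd → (ℕ → ℕ) → (ℕ → ℕ → ℕ) → (ℕ → ℕ → ℕ)
  | .store a idx e, ρ, A =>
      Function.update A a (Function.update (A a) (idx.eval n A ρ) (e.eval n A ρ))
  | .seq P Q, ρ, A => Q.run n ρ (P.run n ρ A)
  | .loop x P, ρ, A => loopRun (P.run n) x ρ A n

/-- `for x < n do P`, as a machine program. Register `2 x + 2` holds the variable `x`; its old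
value is kept in register `k`. -/
def loopProg (x k : ℕ) (P : Program) : Program :=
  .seq (.assign k (.reg (2 * x + 2))) <|
  .seq (.assign (2 * x + 2) (.const 0)) <|
  .seq (.loop (.sub (.reg 0) (.reg (2 * x + 2)))
      (.seq P (.assign (2 * x + 2) (.add (.reg (2 * x + 2)) (.const 1)))))
    (.assign (2 * x + 2) (.reg k))

/-- Translation of a term: the value is left in register `2 d + 1`. Register 0 holds the input
size, the other registers of even number hold the variables, and the registers of odd number
from `2 d + 1` on are used as scratch space. -/
def Term.compile : Term → ℕ → Program
  | .const c, d => .assign (2 * d + 1) (.const c)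
  | .size, d => .assign (2 * d + 1) (.reg 0)
  | .var x, d => .assign (2 * d + 1) (.reg (2 * x + 2))
  | .get a e, d => .seq (e.compile d) (.assign (2 * d + 1) (.get a (.reg (2 * d + 1))))
  | .add e f, d => .seq (e.compile d) (.seq (f.compile (d + 1))
      (.assign (2 * d + 1) (.add (.reg (2 * d + 1)) (.reg (2 * d + 3)))))
  | .sub e f, d => .seq (e.compile d) (.seq (f.compile (d + 1))
      (.assign (2 * d + 1) (.sub (.reg (2 * d + 1)) (.reg (2 * d + 3)))))
  | .ite c e f, d => .seq (c.compile d) (.branch (.reg (2 * d + 1)) (e.compile d) (f.compile d))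
  | .scale e, d => .seq (e.compile d) <| .seq (.assign (2 * d + 3) (.reg 0)) <|
      .seq (.assign (2 * d + 5) (.const 0)) <|
      .seq (.loop (.reg (2 * d + 3))
        (.seq (.assign (2 * d + 5) (.add (.reg (2 * d + 5)) (.reg (2 * d + 1))))
          (.assign (2 * d + 3) (.sub (.reg (2 * d + 3)) (.const 1)))))
        (.assign (2 * d + 1) (.reg (2 * d + 5)))
  | .sum x e, d => .seq (.assign (2 * d + 1) (.const 0)) <|
      loopProg x (2 * d + 3) (.seq (e.compile (d + 2))
        (.assign (2 * d + 1) (.add (.reg (2 * d + 1)) (.reg (2 * d + 5)))))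
  | .sup x e, d => .seq (.assign (2 * d + 1) (.const 0)) <|
      loopProg x (2 * d + 3) (.seq (e.compile (d + 2))
        (.assign (2 * d + 1) (.add (.reg (2 * d + 1))
          (.sub (.reg (2 * d + 5)) (.reg (2 * d + 1))))))

/-- Translation of a command; the registers of odd number from `2 d + 1` on are scratch space. -/
def Cmd.compile : Cmd → ℕ → Program
  | .store a idx e, d => .seq (idx.compile d) (.seq (e.compile (d + 1))
      (.store a (.reg (2 * d + 1)) (.reg (2 * d + 3))))
  | .seq P Q, d => .seq (P.compile d) (Q.compile d)
  | .loop x P, d => loopProg x (2 * d + 1) (P.compile (d + 1))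

/-- `s'` agrees with `s` on the register of the input size, the variables and the registers in
use below scratch level `d`. -/
def Frame (d : ℕ) (s s' : State) : Prop :=
  ∀ i, (Even i ∨ i < 2 * d + 1) → s'.reg i = s.reg i

/-- The values of the variables in a machine state. -/
def State.vars (s : State) : ℕ → ℕ := fun x => s.reg (2 * x + 2)

theorem Frame.vars_eq {d : ℕ} {s s' : State} (h : Frame d s s') : s'.vars = s.vars := by
  funext x
  exact h _ (Or.inl ⟨x + 1, by ring⟩)

theorem Frame.size_eq {d : ℕ} {s s' : State} (h : Frame d s s') : s'.reg 0 = s.reg 0 :=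
  h 0 (Or.inl ⟨0, rfl⟩)

theorem Frame.trans {d e : ℕ} {s s' s'' : State} (h : Frame d s s') (h' : Frame e s' s'')
    (hde : d ≤ e) : Frame d s s'' := by
  intro i hi
  rw [h' i (hi.imp_right fun h => by omega), h i hi]

/-- The loop rule: if every round establishes the invariant `I` for the next value of the loop
variable, in at most `T` steps, then the loop ends with `I n`, the loop variable having its
old value. The invariant must not depend on the loop variable and the register `k`. -/
theorem exec_loopProg {x k : ℕ} {P : Program} {s : State} {T : ℕ} (I : ℕ → State → Prop)
    (hn : ∀ m s', I m s' → s'.reg 0 = s.reg 0 ∧ s'.reg k = s.reg (2 * x + 2))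
    (hI : ∀ m s' v, I m s' → I m (s'.setReg (2 * x + 2) v))
    (h0 : I 0 (s.setReg k (s.reg (2 * x + 2))))
    (hP : ∀ m s', m < s.reg 0 → I m s' → s'.reg (2 * x + 2) = m →
      ∃ t s'', Exec P s' t s'' ∧ t ≤ T ∧ I (m + 1) s'' ∧ s''.reg (2 * x + 2) = m) :
    ∃ t s', Exec (loopProg x k P) s t s' ∧ t ≤ s.reg 0 * (T + 8) + 10 ∧
      I (s.reg 0) s' ∧ s'.reg (2 * x + 2) = s.reg (2 * x + 2) := by
  have key : ∀ l m s', m + l = s.reg 0 → I m s' → s'.reg (2 * x + 2) = m →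
      ∃ t s'', Exec (.loop (.sub (.reg 0) (.reg (2 * x + 2)))
        (.seq P (.assign (2 * x + 2) (.add (.reg (2 * x + 2)) (.const 1))))) s' t s'' ∧
        t ≤ l * (T + 8) + 4 ∧ I (s.reg 0) s'' := by
    intro l
    induction l with
    | zero =>
      intro m s' hm hs hv
      refine ⟨_, s', .loop_false ?_, ?_, ?_⟩
      · simp only [RExpr.eval]; rw [hv, (hn _ _ hs).1]; omega
      · simp [RExpr.cost]
      · rwa [← hm]
    | succ l ih =>
      intro m s' hm hs hv
      obtain ⟨t, s'', he, ht, hs'', hv''⟩ := hP m s' (by omega) hs hv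
      obtain ⟨t', s₃, he', ht', hs₃⟩ := ih (m + 1) (s''.setReg (2 * x + 2) (m + 1)) (by omega)
        (hI _ _ _ hs'') (by simp [State.setReg])
      refine ⟨_, s₃, .loop_true (t' := t') ?_ (.seq he (.assign _ _ _)) ?_, ?_, hs₃⟩
      · simp only [RExpr.eval]; rw [hv, (hn _ _ hs).1]; omega
      · simpa only [RExpr.eval, hv''] using he'
      · simp only [RExpr.cost]; nlinarith
  obtain ⟨t, s', he, ht, hs'⟩ := key (s.reg 0) 0
    ((s.setReg k (s.reg (2 * x + 2))).setReg (2 * x + 2) 0) (by simp) (hI _ _ _ h0)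
    (by simp [State.setReg])
  refine ⟨_, _, .seq (.assign _ _ _) (.seq (.assign _ _ _) (.seq he (.assign _ _ _))), ?_,
    hI _ _ _ hs', ?_⟩
  · simp only [RExpr.cost]; omega
  · simp [State.setReg, RExpr.eval, (hn _ _ hs').2]

/-- Specification of a translated term: it computes the value, keeps what is outside of the
scratch space, and takes at most `T` steps on inputs of size `n`. -/
def Term.Runs (e : Term) (n T : ℕ) : Prop :=
  ∀ d s, s.reg 0 = n → ∃ t s', Exec (e.compile d) s t s' ∧ t ≤ T ∧
    s'.reg (2 * d + 1) = e.eval n s.arr s.vars ∧ Frame d s s' ∧ s'.arr = s.arr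

theorem frame_setReg {d k : ℕ} {s : State} (v : ℕ) (hk : Odd k) (hd : 2 * d + 1 ≤ k) :
    Frame d s (s.setReg k v) := by
  intro i hi
  have : i ≠ k := by
    rintro rfl
    rcases hi with h | h
    · exact (Nat.not_even_iff_odd.2 hk) h
    · omega
  simp [State.setReg, this]

/-- The common part of sums and maxima: a loop that folds the values of `e` into register
`2 d + 1` by means of the expression `op`. -/
theorem Term.runs_fold {e : Term} {n T : ℕ} (he : e.Runs n T) (x d : ℕ) (s : State)
    (hs : s.reg 0 = n) (op : RExpr) (f : ℕ → ℕ → ℕ) (hop : op.cost ≤ 5)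
    (hf : ∀ s : State, op.eval s = f (s.reg (2 * d + 1)) (s.reg (2 * d + 5)))
    (F : ℕ → ℕ) (hF0 : F 0 = 0)
    (hF : ∀ m, F (m + 1) = f (F m) (e.eval n s.arr (Function.update s.vars x m))) :
    ∃ t s', Exec (.seq (.assign (2 * d + 1) (.const 0)) <| loopProg x (2 * d + 3)
        (.seq (e.compile (d + 2)) (.assign (2 * d + 1) op))) s t s' ∧
      t ≤ n * (T + 14) + 12 ∧ s'.reg (2 * d + 1) = F n ∧ Frame d s s' ∧ s'.arr = s.arr := by
  obtain ⟨t, s', hex, ht, hI, hx⟩ := exec_loopProg (x := x) (k := 2 * d + 3)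
    (P := .seq (e.compile (d + 2)) (.assign (2 * d + 1) op))
    (s := s.setReg (2 * d + 1) 0) (T := T + 6)
    (fun m s' => s'.reg (2 * d + 1) = F m ∧ s'.reg (2 * d + 3) = s.reg (2 * x + 2) ∧
      (∀ i, (Even i ∨ i < 2 * d + 1) → i ≠ 2 * x + 2 → s'.reg i = s.reg i) ∧ s'.arr = s.arr)
    (by
      rintro m s' ⟨-, h2, h3, -⟩
      refine ⟨?_, ?_⟩
      · rw [h3 0 (Or.inl ⟨0, rfl⟩) (by omega)]; simp [State.setReg]
      · rw [h2]; simp [State.setReg, show 2 * x + 2 ≠ 2 * d + 1 by omega])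
    (by
      rintro m s' v ⟨h1, h2, h3, h4⟩
      refine ⟨?_, ?_, ?_, h4⟩
      · simpa only [State.setReg, Function.update_of_ne (show 2 * d + 1 ≠ 2 * x + 2 by omega)]
          using h1
      · simpa only [State.setReg, Function.update_of_ne (show 2 * d + 3 ≠ 2 * x + 2 by omega)]
          using h2
      · intro i hi hix
        simpa [State.setReg, hix] using h3 i hi hix)
    (by
      refine ⟨?_, ?_, ?_, rfl⟩
      · simp [State.setReg, hF0]
      · simp [State.setReg, show 2 * x + 2 ≠ 2 * d + 1 by omega]
      · intro i hi hix
        have h1 : i ≠ 2 * d + 1 := by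
          rintro rfl; rcases hi with h | h
          · rcases h with ⟨r, hr⟩; omega
          · omega
        have h2 : i ≠ 2 * d + 3 := by
          rintro rfl; rcases hi with h | h
          · rcases h with ⟨r, hr⟩; omega
          · omega
        simp [State.setReg, h1, h2])
    (by
      rintro m s' hm ⟨h1, h2, h3, h4⟩ hv
      have h0 : s'.reg 0 = n := by rw [h3 0 (Or.inl ⟨0, rfl⟩) (by omega), hs]
      obtain ⟨t, s'', hex, ht, hval, hfr, harr⟩ := he (d + 2) s' h0
      have hvars : s'.vars = Function.update s.vars x m := by
        funext y
        by_cases hy : y = x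
        · subst hy; simp [State.vars, hv]
        · simp only [State.vars, Function.update_of_ne hy]
          exact h3 _ (Or.inl ⟨y + 1, by ring⟩) (by omega)
      refine ⟨_, _, .seq hex (.assign _ _ _), by omega, ⟨?_, ?_, ?_, ?_⟩, ?_⟩
      · rw [hf, hF, ← h1, ← hfr (2 * d + 1) (Or.inr (by omega))]
        simp only [State.setReg, Function.update_self]
        rw [show 2 * d + 5 = 2 * (d + 2) + 1 by ring, hval, h4, hvars]
      · simp [State.setReg, hfr (2 * d + 3) (Or.inr (by omega)), h2]
      · intro i hi hix
        have h1 : i ≠ 2 * d + 1 := by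
          rintro rfl; rcases hi with h | h
          · rcases h with ⟨r, hr⟩; omega
          · omega
        simp only [State.setReg, Function.update_of_ne h1]
        rw [hfr i (hi.imp_right fun h => by omega), h3 i hi hix]
      · simp [State.setReg, harr, h4]
      · simp only [State.setReg, Function.update_of_ne (show 2 * x + 2 ≠ 2 * d + 1 by omega)]
        rw [hfr _ (Or.inl ⟨x + 1, by ring⟩), hv])
  have hs' : (s.setReg (2 * d + 1) 0).reg 0 = n := by simp [State.setReg, hs]
  rw [hs'] at ht hI
  refine ⟨_, s', .seq (.assign _ _ _) hex, ?_, hI.1, ?_, hI.2.2.2⟩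
  · simp only [RExpr.cost]; nlinarith
  · intro i hi
    by_cases hix : i = 2 * x + 2
    · subst hix; rw [hx]; simp [State.setReg, show 2 * x + 2 ≠ 2 * d + 1 by omega]
    · exact hI.2.2.1 i hi hix

/-- Two terms evaluated one after the other; the scratch space of the second starts above the value
of the first. -/
theorem Term.runs_binary {e f : Term} {n T T' : ℕ} (he : e.Runs n T) (hf : f.Runs n T')
    (d : ℕ) (s : State) (hs : s.reg 0 = n) :
    ∃ t s', Exec (.seq (e.compile d) (f.compile (d + 1))) s t s' ∧ t ≤ T + T' ∧
      s'.reg (2 * d + 1) = e.eval n s.arr s.vars ∧ s'.reg (2 * d + 3) = f.eval n s.arr s.vars ∧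
      Frame d s s' ∧ s'.arr = s.arr := by
  obtain ⟨t, s', hex, ht, hval, hfr, harr⟩ := he d s hs
  obtain ⟨t', s'', hex', ht', hval', hfr', harr'⟩ := hf (d + 1) s' (by rw [hfr.size_eq, hs])
  refine ⟨_, s'', .seq hex hex', by omega, ?_, ?_, hfr.trans hfr' (by omega), by rw [harr', harr]⟩
  · rw [hfr' _ (Or.inr (by omega)), hval]
  · rw [show 2 * d + 3 = 2 * (d + 1) + 1 by ring, hval', hfr.vars_eq, harr]

theorem exec_assoc {P Q R : Program} {s s' : State} {t : ℕ}
    (h : Exec (.seq (.seq P Q) R) s t s') : Exec (.seq P (.seq Q R)) s t s' := by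
  cases h with
  | seq h1 h2 => cases h1 with
    | seq h3 h4 => rw [add_assoc]; exact .seq h3 (.seq h4 h2)

theorem sup_range_succ_eq_add_sub (f : ℕ → ℕ) (m : ℕ) :
    (Finset.range (m + 1)).sup f = (Finset.range m).sup f + (f m - (Finset.range m).sup f) := by
  rw [Finset.range_add_one, Finset.sup_insert]
  rcases le_total (f m) ((Finset.range m).sup f) with h | h
  · rw [sup_eq_right.2 h]; omega
  · rw [sup_eq_left.2 h]; omega

/-- Every term is evaluated in polynomial time. -/
theorem Term.exists_runs (e : Term) : ∃ p : Polynomial ℕ, ∀ n, e.Runs n (p.eval n) := by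
  induction e with
  | const c =>
    refine ⟨Polynomial.C 2, fun n d s hs => ⟨_, _, .assign _ _ _, by simp [RExpr.cost], ?_,
      frame_setReg _ ⟨d, rfl⟩ le_rfl, rfl⟩⟩
    simp [State.setReg, RExpr.eval, Term.eval]
  | size =>
    refine ⟨Polynomial.C 2, fun n d s hs => ⟨_, _, .assign _ _ _, by simp [RExpr.cost], ?_,
      frame_setReg _ ⟨d, rfl⟩ le_rfl, rfl⟩⟩
    simp [State.setReg, RExpr.eval, Term.eval, hs]
  | var x =>
    refine ⟨Polynomial.C 2, fun n d s hs => ⟨_, _, .assign _ _ _, by simp [RExpr.cost], ?_,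
      frame_setReg _ ⟨d, rfl⟩ le_rfl, rfl⟩⟩
    simp [State.setReg, RExpr.eval, Term.eval, State.vars]
  | get a e ih =>
    obtain ⟨p, hp⟩ := ih
    refine ⟨p + Polynomial.C 3, fun n d s hs => ?_⟩
    obtain ⟨t, s', hex, ht, hval, hfr, harr⟩ := hp n d s hs
    refine ⟨_, _, .seq hex (.assign _ _ _), ?_, ?_,
      hfr.trans (frame_setReg _ ⟨d, rfl⟩ le_rfl) le_rfl, harr⟩
    · simp [RExpr.cost]; omega
    · simp [State.setReg, RExpr.eval, Term.eval, hval, harr]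
  | add e f ihe ihf =>
    obtain ⟨p, hp⟩ := ihe
    obtain ⟨q, hq⟩ := ihf
    refine ⟨p + q + Polynomial.C 4, fun n d s hs => ?_⟩
    obtain ⟨t, s', hex, ht, hval, hval', hfr, harr⟩ := runs_binary (hp n) (hq n) d s hs
    refine ⟨_, _, exec_assoc (.seq hex (.assign _ _ _)), ?_, ?_,
      hfr.trans (frame_setReg _ ⟨d, rfl⟩ le_rfl) le_rfl, harr⟩
    · simp [RExpr.cost]; omega
    · simp [State.setReg, RExpr.eval, Term.eval, hval, hval']
  | sub e f ihe ihf =>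
    obtain ⟨p, hp⟩ := ihe
    obtain ⟨q, hq⟩ := ihf
    refine ⟨p + q + Polynomial.C 4, fun n d s hs => ?_⟩
    obtain ⟨t, s', hex, ht, hval, hval', hfr, harr⟩ := runs_binary (hp n) (hq n) d s hs
    refine ⟨_, _, exec_assoc (.seq hex (.assign _ _ _)), ?_, ?_,
      hfr.trans (frame_setReg _ ⟨d, rfl⟩ le_rfl) le_rfl, harr⟩
    · simp [RExpr.cost]; omega
    · simp [State.setReg, RExpr.eval, Term.eval, hval, hval']
  | ite c e f ihc ihe ihf =>
    obtain ⟨r, hr⟩ := ihc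
    obtain ⟨p, hp⟩ := ihe
    obtain ⟨q, hq⟩ := ihf
    refine ⟨r + p + q + Polynomial.C 2, fun n d s hs => ?_⟩
    obtain ⟨t, s', hex, ht, hval, hfr, harr⟩ := hr n d s hs
    by_cases hc : c.eval n s.arr s.vars = 0
    · obtain ⟨t', s'', hex', ht', hval', hfr', harr'⟩ := hq n d s' (by rw [hfr.size_eq, hs])
      refine ⟨_, _, .seq hex (.branch_false (by simpa [RExpr.eval, hval] using hc) hex'), ?_, ?_,
        hfr.trans hfr' le_rfl, by rw [harr', harr]⟩
      · simp [RExpr.cost]; omega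
      · simp [Term.eval, hval', hc, hfr.vars_eq, harr]
    · obtain ⟨t', s'', hex', ht', hval', hfr', harr'⟩ := hp n d s' (by rw [hfr.size_eq, hs])
      refine ⟨_, _, .seq hex (.branch_true (by simpa [RExpr.eval, hval] using hc) hex'), ?_, ?_,
        hfr.trans hfr' le_rfl, by rw [harr', harr]⟩
      · simp [RExpr.cost]; omega
      · simp [Term.eval, hval', hc, hfr.vars_eq, harr]
  | scale e ih =>
    obtain ⟨p, hp⟩ := ih
    refine ⟨p + Polynomial.C 8 + Polynomial.X * Polynomial.C 10, fun n d s hs => ?_⟩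
    obtain ⟨t, s', hex, ht, hval, hfr, harr⟩ := hp n d s hs
    have key : ∀ m (u : State), u.reg (2 * d + 3) = m → ∃ t u', Exec (.loop (.reg (2 * d + 3))
        (.seq (.assign (2 * d + 5) (.add (.reg (2 * d + 5)) (.reg (2 * d + 1))))
          (.assign (2 * d + 3) (.sub (.reg (2 * d + 3)) (.const 1))))) u t u' ∧
        t ≤ m * 10 + 2 ∧ u'.reg (2 * d + 5) = u.reg (2 * d + 5) + m * u.reg (2 * d + 1) ∧
        Frame d u u' ∧ u'.arr = u.arr := by
      intro m
      induction m with
      | zero =>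
        intro u hu
        exact ⟨_, u, .loop_false hu, by simp [RExpr.cost], by simp, fun _ _ => rfl, rfl⟩
      | succ m ih =>
        intro u hu
        obtain ⟨t, u', hex, ht, hval, hfr, harr⟩ := ih
          ((u.setReg (2 * d + 5) (u.reg (2 * d + 5) + u.reg (2 * d + 1))).setReg (2 * d + 3) m)
          (by simp [State.setReg])
        refine ⟨_, u', .loop_true (by simp [RExpr.eval, hu])
          (.seq (.assign _ _ _) (.assign _ _ _)) (t' := t) ?_, ?_, ?_, ?_, harr⟩
        · simpa [RExpr.eval, State.setReg, hu] using hex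
        · simp only [RExpr.cost]; omega
        · rw [hval]; simp [State.setReg]; ring
        · exact ((frame_setReg _ ⟨d + 2, by ring⟩ (by omega)).trans
            (frame_setReg _ ⟨d + 1, by ring⟩ (by omega)) le_rfl).trans hfr le_rfl
    obtain ⟨t', u, hex', ht', hval', hfr', harr'⟩ := key n
      ((s'.setReg (2 * d + 3) (s'.reg 0)).setReg (2 * d + 5) 0)
      (by simp [State.setReg, hfr.size_eq, hs])
    refine ⟨_, _, .seq hex (.seq (.assign _ _ _) (.seq (.assign _ _ _) (.seq (t := t') (s' := u) ?_
      (.assign _ _ _)))), ?_, ?_, ?_, ?_⟩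
    · simpa [RExpr.eval] using hex'
    · simp [RExpr.cost]; omega
    · simp only [State.setReg, RExpr.eval, Function.update_self, Term.eval] at hval' ⊢
      rw [hval', ← hval]
      simp
    · exact (((hfr.trans (frame_setReg _ ⟨d + 1, by ring⟩ (by omega)) le_rfl).trans
        (frame_setReg _ ⟨d + 2, by ring⟩ (by omega)) le_rfl).trans hfr' le_rfl).trans
        (frame_setReg _ ⟨d, by ring⟩ (by omega)) le_rfl
    · simpa [State.setReg, harr] using harr'
  | sum x e ih =>
    obtain ⟨p, hp⟩ := ih
    refine ⟨Polynomial.X * (p + Polynomial.C 14) + Polynomial.C 12, fun n d s hs => ?_⟩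
    have := runs_fold (hp n) x d s hs (.add (.reg (2 * d + 1)) (.reg (2 * d + 5)))
      (fun u v => u + v) (by simp [RExpr.cost]) (fun _ => rfl)
      (fun m => ∑ v ∈ Finset.range m, e.eval n s.arr (Function.update s.vars x v)) (by simp)
      (fun m => Finset.sum_range_succ _ _)
    simpa [Term.eval, Term.compile] using this
  | sup x e ih =>
    obtain ⟨p, hp⟩ := ih
    refine ⟨Polynomial.X * (p + Polynomial.C 14) + Polynomial.C 12, fun n d s hs => ?_⟩
    have := runs_fold (hp n) x d s hs
      (.add (.reg (2 * d + 1)) (.sub (.reg (2 * d + 5)) (.reg (2 * d + 1))))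
      (fun u v => u + (v - u)) (by simp [RExpr.cost]) (fun _ => rfl)
      (fun m => (Finset.range m).sup fun v => e.eval n s.arr (Function.update s.vars x v))
      (by simp) (fun m => sup_range_succ_eq_add_sub _ _)
    simpa [Term.eval, Term.compile] using this

/-- Every command runs in polynomial time. -/
theorem Cmd.exists_runs (P : Cmd) : ∃ p : Polynomial ℕ, ∀ n d s, s.reg 0 = n →
    ∃ t s', Exec (P.compile d) s t s' ∧ t ≤ p.eval n ∧ s'.arr = P.run n s.vars s.arr ∧
      Frame d s s' := by
  induction P with
  | store a idx e =>
    obtain ⟨p, hp⟩ := idx.exists_runs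
    obtain ⟨q, hq⟩ := e.exists_runs
    refine ⟨p + q + Polynomial.C 3, fun n d s hs => ?_⟩
    obtain ⟨t, s', hex, ht, hval, hval', hfr, harr⟩ := Term.runs_binary (hp n) (hq n) d s hs
    refine ⟨_, _, exec_assoc (.seq hex (.store _ _ _ _)), ?_, ?_, ?_⟩
    · simp [RExpr.cost]; omega
    · simp [State.setArr, Cmd.run, RExpr.eval, hval, hval', harr]
    · exact fun i hi => hfr i hi
  | seq P Q ihP ihQ =>
    obtain ⟨p, hp⟩ := ihP
    obtain ⟨q, hq⟩ := ihQ
    refine ⟨p + q, fun n d s hs => ?_⟩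
    obtain ⟨t, s', hex, ht, harr, hfr⟩ := hp n d s hs
    obtain ⟨t', s'', hex', ht', harr', hfr'⟩ := hq n d s' (by rw [hfr.size_eq, hs])
    refine ⟨_, _, .seq hex hex', ?_, ?_, hfr.trans hfr' le_rfl⟩
    · simp; omega
    · rw [harr', hfr.vars_eq, harr]; rfl
  | loop x P ih =>
    obtain ⟨p, hp⟩ := ih
    refine ⟨Polynomial.X * (p + Polynomial.C 8) + Polynomial.C 10, fun n d s hs => ?_⟩
    obtain ⟨t, s', hex, ht, hI, hx⟩ := exec_loopProg (x := x) (k := 2 * d + 1)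
      (P := P.compile (d + 1)) (s := s) (T := p.eval n)
      (fun m s' => s'.arr = loopRun (P.run n) x s.vars s.arr m ∧
        s'.reg (2 * d + 1) = s.reg (2 * x + 2) ∧
        (∀ i, (Even i ∨ i < 2 * d + 1) → i ≠ 2 * x + 2 → s'.reg i = s.reg i))
      (fun m s' h => ⟨h.2.2 0 (Or.inl ⟨0, rfl⟩) (by omega), h.2.1⟩)
      (by
        rintro m s' v ⟨h1, h2, h3⟩
        refine ⟨h1, ?_, ?_⟩
        · simpa only [State.setReg, Function.update_of_ne (show 2 * d + 1 ≠ 2 * x + 2 by omega)]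
            using h2
        · intro i hi hix
          simpa [State.setReg, hix] using h3 i hi hix)
      (by
        refine ⟨rfl, by simp [State.setReg], fun i hi _ => ?_⟩
        exact frame_setReg (d := d) _ ⟨d, rfl⟩ le_rfl i hi)
      (by
        rintro m s' hm ⟨h1, h2, h3⟩ hv
        have h0 : s'.reg 0 = n := by rw [h3 0 (Or.inl ⟨0, rfl⟩) (by omega), hs]
        obtain ⟨t, s'', hex, ht, harr, hfr⟩ := hp n (d + 1) s' h0
        have hvars : s'.vars = Function.update s.vars x m := by
          funext y
          by_cases hy : y = x
          · subst hy; simp [State.vars, hv]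
          · simp only [State.vars, Function.update_of_ne hy]
            exact h3 _ (Or.inl ⟨y + 1, by ring⟩) (by omega)
        refine ⟨t, s'', hex, ht, ⟨?_, ?_, ?_⟩, ?_⟩
        · rw [harr, hvars, h1]; rfl
        · rw [hfr _ (Or.inr (by omega)), h2]
        · intro i hi hix
          rw [hfr i (hi.imp_right fun h => by omega), h3 i hi hix]
        · rw [hfr _ (Or.inl ⟨x + 1, by ring⟩), hv])
    rw [hs] at ht hI
    refine ⟨t, s', hex, by simpa using ht, hI.1, fun i hi => ?_⟩
    by_cases hix : i = 2 * x + 2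
    · subst hix; exact hx
    · exact hI.2.2 i hi hix

/-- A command followed by the evaluation of a term is a polynomial-time machine program. Registers
0, 1, 2 hold the input size and the variables 1 and 0. -/
theorem exists_program (P : Cmd) (e : Term) : ∃ (Q : Program) (p : Polynomial ℕ), ∀ s : State,
    ∃ (t : ℕ) (s' : State), Exec Q s t s' ∧ t ≤ p.eval (s.reg 0) ∧
      ∃ ρ : ℕ → ℕ, ρ 0 = s.reg 2 ∧ ρ 1 = s.reg 1 ∧
        s'.reg 0 = e.eval (s.reg 0) (P.run (s.reg 0) ρ s.arr) ρ := by
  obtain ⟨p, hp⟩ := P.exists_runs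
  obtain ⟨q, hq⟩ := e.exists_runs
  refine ⟨.seq (.assign 4 (.reg 1)) (.seq (P.compile 0) (.seq (e.compile 0) (.assign 0 (.reg 1)))),
    p + q + Polynomial.C 4, fun s => ?_⟩
  obtain ⟨t, s', hex, ht, harr, hfr⟩ := hp (s.reg 0) 0 (s.setReg 4 (s.reg 1))
    (by simp [State.setReg])
  have hs' : s'.reg 0 = s.reg 0 := by rw [hfr.size_eq]; simp [State.setReg]
  obtain ⟨t', s'', hex', ht', hval, -, -⟩ := hq (s.reg 0) 0 s' hs'
  refine ⟨_, _, .seq (.assign _ _ _) (.seq hex (.seq hex' (.assign _ _ _))), ?_,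
    (s.setReg 4 (s.reg 1)).vars, by simp [State.vars, State.setReg],
    by simp [State.vars, State.setReg], ?_⟩
  · simp [RExpr.cost]; omega
  · rw [harr, hfr.vars_eq] at hval
    simpa [State.setReg, RExpr.eval] using hval

end BW

/-! ### Γ-free matrices and dynamic programming -/

namespace BW

open Finset

/-- A 0/1-matrix, given as a relation between rows and columns, is Γ-free if it has no submatrix
with two rows and two columns, in this order, whose only zero is the last entry. -/
def GammaFree (M : ℕ → ℕ → Prop) : Prop :=
  ∀ i i' j j', i < i' → j < j' → M i j → M i j' → M i' j → M i' j'

/-- Two rows share one of the first `t` columns. -/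
def Share (M : ℕ → ℕ → Prop) (t a b : ℕ) : Prop := ∃ j < t, M a j ∧ M b j

/-- There is an increasing sequence of rows from `r` to `c` in which consecutive rows share one of
the first `t` columns. -/
def Up (M : ℕ → ℕ → Prop) (t : ℕ) : ℕ → ℕ → Prop :=
  Relation.ReflTransGen fun a b => a < b ∧ Share M t a b

variable {M : ℕ → ℕ → Prop} {t : ℕ}

theorem Share.symm {a b : ℕ} (h : Share M t a b) : Share M t b a := by
  obtain ⟨j, hj, ha, hb⟩ := h
  exact ⟨j, hj, hb, ha⟩

theorem Up.le {r c : ℕ} (h : Up M t r c) : r ≤ c := by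
  induction h with
  | refl => exact le_rfl
  | tail _ h ih => exact ih.trans h.1.le

theorem Up.mono {r c t' : ℕ} (h : Up M t r c) (ht : t ≤ t') : Up M t' r c := by
  induction h with
  | refl => exact .refl
  | tail _ hs ih => exact ih.tail ⟨hs.1, hs.2.imp fun _ hj => ⟨hj.1.trans_le ht, hj.2⟩⟩

theorem GammaFree.share (hM : GammaFree M) {r a b : ℕ} (ha : r < a) (hb : r < b)
    (hra : Share M t r a) (hrb : Share M t r b) : Share M t a b := by
  obtain ⟨j, hj, h1, h2⟩ := hra
  obtain ⟨j', hj', h3, h4⟩ := hrb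
  rcases lt_trichotomy j j' with h | rfl | h
  · exact ⟨j', hj', hM r a j j' ha h h1 h3 h2, h4⟩
  · exact ⟨j, hj, h2, h4⟩
  · exact ⟨j, hj, h2, hM r b j' j hb h h3 h1 h4⟩

theorem Up.comparable_of_share (hM : GammaFree M) {r c : ℕ} (h : Up M t r c) :
    ∀ d, r < d → Share M t r d → Up M t d c ∨ Up M t c d := by
  induction h using Relation.ReflTransGen.head_induction_on with
  | refl => exact fun d hd hs => Or.inr (.single ⟨hd, hs⟩)
  | head hstep hrest ih =>
    intro d hd hs
    have hs' := hM.share hd hstep.1 hs hstep.2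
    rename_i r r₁
    rcases lt_trichotomy d r₁ with h | rfl | h
    · exact Or.inl (.head ⟨h, hs'⟩ hrest)
    · exact Or.inl hrest
    · exact ih d h hs'.symm

/-- The rows above a given row form a chain: `Up M t` is the ancestor relation of a forest. -/
theorem Up.comparable (hM : GammaFree M) {r c c' : ℕ} (h : Up M t r c) (h' : Up M t r c') :
    Up M t c c' ∨ Up M t c' c := by
  induction h using Relation.ReflTransGen.head_induction_on with
  | refl => exact Or.inl h'
  | head hstep hrest ih =>
    rcases Up.comparable_of_share hM h' _ hstep.1 hstep.2 with h | h
    · exact ih h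
    · exact Or.inr (Relation.ReflTransGen.trans h hrest)

/-- Row `r` is the first row of column `j`. -/
def First (M : ℕ → ℕ → Prop) (r j : ℕ) : Prop := M r j ∧ ∀ r' < r, ¬ M r' j

open Classical in
/-- The number of columns among the first `t` whose first row is in `Z` and whose rows in `Z`
are all in `C`. -/
noncomputable def gain (M : ℕ → ℕ → Prop) (Z : Finset ℕ) (t : ℕ) (C : Finset ℕ) : ℕ :=
  #{j ∈ range t | (∃ r ∈ Z, First M r j) ∧ ∀ r ∈ Z, M r j → r ∈ C}

/-- The largest gain of a subset of `Z` with at most `y` elements. -/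
noncomputable def best (M : ℕ → ℕ → Prop) (Z : Finset ℕ) (t y : ℕ) : ℕ :=
  ({C ∈ Z.powerset | #C ≤ y} : Finset (Finset ℕ)).sup (gain M Z t)

theorem gain_le_best {Z C : Finset ℕ} {y : ℕ} (hC : C ⊆ Z) (hy : #C ≤ y) :
    gain M Z t C ≤ best M Z t y :=
  le_sup (f := gain M Z t) (by simp [hC, hy])

theorem exists_gain_eq_best (M : ℕ → ℕ → Prop) (Z : Finset ℕ) (t y : ℕ) :
    ∃ C ⊆ Z, #C ≤ y ∧ gain M Z t C = best M Z t y := by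
  obtain ⟨C, hC, h⟩ := exists_mem_eq_sup ({C ∈ Z.powerset | #C ≤ y} : Finset (Finset ℕ))
    ⟨∅, by simp⟩ (gain M Z t)
  simp only [mem_filter, mem_powerset] at hC
  exact ⟨C, hC.1, hC.2, h.symm⟩

theorem best_le {Z : Finset ℕ} {y m : ℕ} (h : ∀ C ⊆ Z, #C ≤ y → gain M Z t C ≤ m) :
    best M Z t y ≤ m := by
  obtain ⟨C, hC, hy, he⟩ := exists_gain_eq_best M Z t y
  exact he ▸ h C hC hy

theorem best_mono {Z : Finset ℕ} {y y' : ℕ} (h : y ≤ y') : best M Z t y ≤ best M Z t y' :=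
  best_le fun _ hC hy => gain_le_best hC (hy.trans h)

theorem best_empty (y : ℕ) : best M ∅ t y = 0 :=
  Nat.le_zero.1 (best_le fun C _ _ => by simp [gain])

theorem best_zero (Z : Finset ℕ) (y : ℕ) : best M Z 0 y = 0 :=
  Nat.le_zero.1 (best_le fun C _ _ => by simp [gain])

open Classical in
/-- Either column `t` is not counted, or all of its rows in `Z` are taken. In the latter case
each column up to `t` that starts in such a row is counted for free, since by Γ-freeness all of its
rows are in column `t`. -/
theorem best_succ (hM : GammaFree M) (Z : Finset ℕ) (t y : ℕ) :
    best M Z (t + 1) y = max (best M Z t y)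
      (if #{r ∈ Z | M r t} ≤ y then
        #{j ∈ range (t + 1) | ∃ r ∈ Z, M r t ∧ First M r j} +
          best M {r ∈ Z | ¬ M r t} t (y - #{r ∈ Z | M r t}) else 0) := by
  apply le_antisymm
  · apply best_le
    intro C hC hy
    by_cases h : ∀ r ∈ Z, M r t → r ∈ C
    · refine le_max_of_le_right ?_
      have hsub : ({r ∈ Z | M r t} : Finset ℕ) ⊆ C := fun r hr => by
        rw [mem_filter] at hr; exact h r hr.1 hr.2
      have hcard : #{r ∈ C | M r t} = #{r ∈ Z | M r t} := by
        congr 1; ext r; simp only [mem_filter]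
        exact ⟨fun hr => ⟨hC hr.1, hr.2⟩, fun hr => ⟨h r hr.1 hr.2, hr.2⟩⟩
      have hsplit := card_filter_add_card_filter_not (s := C) (fun r => M r t)
      rw [if_pos ((card_le_card hsub).trans hy)]
      have hb : gain M {r ∈ Z | ¬ M r t} t {r ∈ C | ¬ M r t} ≤
          best M {r ∈ Z | ¬ M r t} t (y - #{r ∈ Z | M r t}) := by
        apply gain_le_best
        · exact filter_subset_filter _ hC
        · omega
      refine le_trans ?_ (Nat.add_le_add_left hb _)
      unfold gain
      rw [← card_filter_add_card_filter_not (fun j => ∃ r ∈ Z, M r t ∧ First M r j)]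
      refine Nat.add_le_add (card_le_card ?_) (card_le_card ?_)
      · intro j; simp only [mem_filter]; tauto
      · intro j
        simp only [mem_filter, mem_range]
        rintro ⟨⟨hj, ⟨r, hr, hf⟩, hall⟩, hno⟩
        have hrt : ¬ M r t := fun hrt => hno ⟨r, hr, hrt, hf⟩
        refine ⟨?_, ⟨r, ⟨hr, hrt⟩, hf⟩, fun r' hr' hm => ⟨hall r' hr'.1 hm, hr'.2⟩⟩
        rcases Nat.lt_succ_iff_lt_or_eq.1 hj with h | rfl
        · exact h
        · exact absurd hf.1 hrt
    · refine le_max_of_le_left (le_trans (card_le_card ?_) (gain_le_best hC hy))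
      intro j
      simp only [mem_filter, mem_range]
      rintro ⟨hj, hf, hall⟩
      refine ⟨?_, hf, hall⟩
      rcases Nat.lt_succ_iff_lt_or_eq.1 hj with h' | rfl
      · exact h'
      · exact absurd hall h
  · refine max_le (best_le fun C hC hy => le_trans (card_le_card ?_) (gain_le_best hC hy)) ?_
    · intro j
      simp only [mem_filter, mem_range]
      rintro ⟨hj, h⟩
      exact ⟨by omega, h⟩
    · split_ifs with hle
      swap
      · exact Nat.zero_le _
      obtain ⟨C, hC, hy, he⟩ := exists_gain_eq_best M {r ∈ Z | ¬ M r t} t (y - #{r ∈ Z | M r t})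
      rw [← he]
      have hC' : C ∪ {r ∈ Z | M r t} ⊆ Z :=
        union_subset (hC.trans (filter_subset _ _)) (filter_subset _ _)
      refine le_trans ?_ (gain_le_best hC' ((card_union_le _ _).trans (by omega)))
      unfold gain
      rw [← card_union_of_disjoint]
      · refine card_le_card ?_
        intro j
        simp only [mem_union, mem_filter, mem_range]
        rintro (⟨hj, r, hr, hrt, hf⟩ | ⟨hj, ⟨r, hr, hf⟩, hall⟩)
        · refine ⟨hj, ⟨r, hr, hf⟩, fun r' hr' hm => Or.inr ⟨hr', ?_⟩⟩
          rcases Nat.lt_succ_iff_lt_or_eq.1 hj with hj | rfl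
          · have : r ≤ r' := by
              by_contra! hlt; exact hf.2 r' hlt hm
            rcases this.eq_or_lt with rfl | hlt
            · exact hrt
            · exact hM r r' j t hlt hj hf.1 hrt hm
          · exact hm
        · refine ⟨by omega, ⟨r, hr.1, hf⟩, fun r' hr' hm => ?_⟩
          by_cases hrt : M r' t
          · exact Or.inr ⟨hr', hrt⟩
          · exact Or.inl (hall r' ⟨hr', hrt⟩ hm)
      · rw [disjoint_left]
        intro j
        simp only [mem_filter, mem_range]
        rintro ⟨-, r, hr, hrt, hf⟩ ⟨-, ⟨r', hr', hf'⟩, -⟩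
        have : r = r' := by
          by_contra hne
          rcases lt_or_gt_of_ne hne with h | h
          · exact hf'.2 r h hf.1
          · exact hf.2 r' h hf'.1
        exact hr'.2 (this ▸ hrt)

/-- The gain is additive for sets of rows that have no column in common. -/
theorem gain_union {Z₁ Z₂ : Finset ℕ} (hsep : ∀ j < t, ∀ r₁ ∈ Z₁, ∀ r₂ ∈ Z₂, M r₁ j → ¬ M r₂ j)
    (C : Finset ℕ) : gain M (Z₁ ∪ Z₂) t C = gain M Z₁ t C + gain M Z₂ t C := by
  classical
  unfold gain
  rw [← card_union_of_disjoint]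
  · congr 1
    ext j
    simp only [mem_union, mem_filter, mem_range]
    constructor
    · rintro ⟨hj, ⟨r, hr | hr, hf⟩, hall⟩
      · exact Or.inl ⟨hj, ⟨r, hr, hf⟩, fun r' hr' hm => hall r' (Or.inl hr') hm⟩
      · exact Or.inr ⟨hj, ⟨r, hr, hf⟩, fun r' hr' hm => hall r' (Or.inr hr') hm⟩
    · rintro (⟨hj, ⟨r, hr, hf⟩, hall⟩ | ⟨hj, ⟨r, hr, hf⟩, hall⟩)
      · refine ⟨hj, ⟨r, Or.inl hr, hf⟩, fun r' hr' hm => ?_⟩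
        rcases hr' with hr' | hr'
        · exact hall r' hr' hm
        · exact absurd hm (hsep j hj r hr r' hr' hf.1)
      · refine ⟨hj, ⟨r, Or.inr hr, hf⟩, fun r' hr' hm => ?_⟩
        rcases hr' with hr' | hr'
        · exact absurd hf.1 (hsep j hj r' hr' r hr hm)
        · exact hall r' hr' hm
  · rw [disjoint_left]
    intro j
    simp only [mem_filter, mem_range]
    rintro ⟨hj, ⟨r, hr, hf⟩, -⟩ ⟨-, ⟨r', hr', hf'⟩, -⟩
    exact hsep j hj r hr r' hr' hf.1 hf'.1

theorem gain_inter (Z C : Finset ℕ) : gain M Z t (C ∩ Z) = gain M Z t C := by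
  classical
  unfold gain
  congr 1
  ext j
  simp only [mem_filter, mem_inter]
  refine and_congr_right fun _ => and_congr_right fun _ => ?_
  exact ⟨fun h r hr hm => (h r hr hm).1, fun h r hr hm => ⟨h r hr hm, hr⟩⟩

/-- For sets of rows that have no column in common, `best` is the max-plus convolution. -/
theorem best_union {Z₁ Z₂ : Finset ℕ} (hd : Disjoint Z₁ Z₂)
    (hsep : ∀ j < t, ∀ r₁ ∈ Z₁, ∀ r₂ ∈ Z₂, M r₁ j → ¬ M r₂ j) (y : ℕ) :
    best M (Z₁ ∪ Z₂) t y = (range (y + 1)).sup fun y₁ => best M Z₁ t y₁ + best M Z₂ t (y - y₁) := by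
  apply le_antisymm
  · apply best_le
    intro C hC hy
    have hcard : #C = #(C ∩ Z₁) + #(C ∩ Z₂) := by
      rw [← card_union_of_disjoint (disjoint_of_subset_left inter_subset_right
        (disjoint_of_subset_right inter_subset_right hd)), ← inter_union_distrib_left,
        inter_eq_left.2 hC]
    refine le_trans ?_ (le_sup (f := fun y₁ => best M Z₁ t y₁ + best M Z₂ t (y - y₁))
      (mem_range.2 (show #(C ∩ Z₁) < y + 1 by omega)))
    rw [gain_union hsep, ← gain_inter Z₁, ← gain_inter Z₂]
    exact Nat.add_le_add (gain_le_best inter_subset_right le_rfl)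
      (gain_le_best inter_subset_right (by omega))
  · refine Finset.sup_le fun y₁ hy₁ => ?_
    rw [mem_range] at hy₁
    obtain ⟨C₁, hC₁, h₁, e₁⟩ := exists_gain_eq_best M Z₁ t y₁
    obtain ⟨C₂, hC₂, h₂, e₂⟩ := exists_gain_eq_best M Z₂ t (y - y₁)
    have i₁ : (C₁ ∪ C₂) ∩ Z₁ = C₁ := by
      rw [union_inter_distrib_right, inter_eq_left.2 hC₁,
        disjoint_iff_inter_eq_empty.1 (disjoint_of_subset_left hC₂ hd.symm), union_empty]
    have i₂ : (C₁ ∪ C₂) ∩ Z₂ = C₂ := by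
      rw [union_inter_distrib_right, inter_eq_left.2 hC₂,
        disjoint_iff_inter_eq_empty.1 (disjoint_of_subset_left hC₁ hd), empty_union]
    calc best M Z₁ t y₁ + best M Z₂ t (y - y₁) = gain M (Z₁ ∪ Z₂) t (C₁ ∪ C₂) := by
          rw [gain_union hsep, ← gain_inter Z₁, ← gain_inter Z₂, i₁, i₂, e₁, e₂]
      _ ≤ _ := gain_le_best (union_subset_union hC₁ hC₂) ((card_union_le _ _).trans (by omega))

open Classical in
/-- The rows below `c` in the forest `Up M t`, including `c`. -/
noncomputable def below (M : ℕ → ℕ → Prop) (n t c : ℕ) : Finset ℕ := {r ∈ range n | Up M t r c}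

/-- The roots of `Z`: no later row of `Z` shares one of the first `t` columns. -/
def Root (M : ℕ → ℕ → Prop) (Z : Finset ℕ) (t c : ℕ) : Prop :=
  c ∈ Z ∧ ∀ d ∈ Z, c < d → ¬ Share M t c d

/-- With each row, `Z` contains the rows below it in the forest `Up M t`. -/
def DownClosed (M : ℕ → ℕ → Prop) (t : ℕ) (Z : Finset ℕ) : Prop :=
  ∀ r c, c ∈ Z → Up M t r c → r ∈ Z

theorem Root.eq_of_up {Z : Finset ℕ} (hZ : DownClosed M t Z) {c d : ℕ} (hc : Root M Z t c)
    (hd : d ∈ Z) (h : Up M t c d) : c = d := by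
  rcases Relation.ReflTransGen.cases_head h with h | ⟨e, he, h⟩
  · exact h
  · exact absurd he.2 (hc.2 e (hZ e d hd h) he.1)

/-- The largest row of `Z` reachable from `r` is a root. -/
theorem exists_root {Z : Finset ℕ} {r : ℕ} (hr : r ∈ Z) : ∃ c, Root M Z t c ∧ Up M t r c := by
  classical
  obtain ⟨c, hc, hmax⟩ := exists_max_image {c ∈ Z | Up M t r c} id
    ⟨r, by simp [hr]; exact .refl⟩
  simp only [mem_filter, id] at hc hmax
  refine ⟨c, ⟨hc.1, fun d hd hlt hs => ?_⟩, hc.2⟩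
  have := hmax d ⟨hd, hc.2.tail ⟨hlt, hs⟩⟩
  omega

open Classical in
/-- The rows of `Z` below one of the roots smaller than `i`. -/
noncomputable def belowRoots (M : ℕ → ℕ → Prop) (n : ℕ) (Z : Finset ℕ) (t i : ℕ) : Finset ℕ :=
  {r ∈ range n | ∃ c < i, Root M Z t c ∧ Up M t r c}

open Classical in
/-- The trees below different roots have no column in common, hence the values for the roots are
combined one by one, by `best_union`. -/
theorem best_belowRoots_succ (hM : GammaFree M) {n : ℕ} {Z : Finset ℕ} (hZ : DownClosed M t Z)
    (i y : ℕ) : best M (belowRoots M n Z t (i + 1)) t y = (range (y + 1)).sup fun y₁ =>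
      best M (belowRoots M n Z t i) t y₁ +
        (if Root M Z t i then best M (below M n t i) t (y - y₁) else 0) := by
  have huniq : ∀ {r r' j c c'}, j < t → Root M Z t c → Root M Z t c' → Up M t r c →
      Up M t r' c' → M r j → M r' j → c = c' := by
    intro r r' j c c' hj hc hc' h h' hm hm'
    wlog hle : r ≤ r' generalizing r r' c c'
    · exact (this hc' hc h' h hm' hm (le_of_not_ge hle)).symm
    have hrr : Up M t r r' := by
      rcases hle.eq_or_lt with rfl | hlt
      · exact .refl
      · exact .single ⟨hlt, j, hj, hm, hm'⟩
    rcases Up.comparable hM h (Relation.ReflTransGen.trans hrr h') with h | h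
    · exact hc.eq_of_up hZ hc'.1 h
    · exact (hc'.eq_of_up hZ hc.1 h).symm
  by_cases hroot : Root M Z t i
  · simp only [if_pos hroot]
    rw [← best_union]
    · congr 1
      ext r
      simp only [belowRoots, below, mem_union, mem_filter, mem_range, Nat.lt_succ_iff_lt_or_eq]
      constructor
      · rintro ⟨hr, c, hc | rfl, hc', hu⟩
        · exact Or.inl ⟨hr, c, hc, hc', hu⟩
        · exact Or.inr ⟨hr, hu⟩
      · rintro (⟨hr, c, hc, hc', hu⟩ | ⟨hr, hu⟩)
        · exact ⟨hr, c, Or.inl hc, hc', hu⟩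
        · exact ⟨hr, i, Or.inr rfl, hroot, hu⟩
    · rw [disjoint_left]
      simp only [belowRoots, below, mem_filter]
      rintro r ⟨-, c, hc, hc', hu⟩ ⟨-, hu'⟩
      have : c = i := by
        rcases Up.comparable hM hu hu' with h | h
        · exact hc'.eq_of_up hZ hroot.1 h
        · exact (hroot.eq_of_up hZ hc'.1 h).symm
      omega
    · simp only [belowRoots, below, mem_filter]
      rintro j hj r ⟨-, c, hc, hc', hu⟩ r' ⟨-, hu'⟩ hm hm'
      have := huniq hj hc' hroot hu hu' hm hm'
      omega
  · have hsame : belowRoots M n Z t (i + 1) = belowRoots M n Z t i := by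
      ext r
      simp only [belowRoots, mem_filter, Nat.lt_succ_iff_lt_or_eq]
      refine and_congr_right fun _ => ⟨?_, ?_⟩
      · rintro ⟨c, hc | rfl, hc', hu⟩
        · exact ⟨c, hc, hc', hu⟩
        · exact absurd hc' hroot
      · rintro ⟨c, hc, h⟩
        exact ⟨c, Or.inl hc, h⟩
    simp only [if_neg hroot, hsame, add_zero]
    apply le_antisymm
    · exact le_sup (f := fun y₁ => best M (belowRoots M n Z t i) t y₁) (self_mem_range_succ y)
    · exact Finset.sup_le fun y₁ h => best_mono (Nat.lt_succ_iff.1 (mem_range.1 h))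

theorem belowRoots_zero {n : ℕ} {Z : Finset ℕ} : belowRoots M n Z t 0 = ∅ := by
  simp [belowRoots]

theorem belowRoots_self {n : ℕ} {Z : Finset ℕ} (hn : Z ⊆ range n) (hZ : DownClosed M t Z) :
    belowRoots M n Z t n = Z := by
  ext r
  simp only [belowRoots, mem_filter]
  constructor
  · rintro ⟨-, c, -, hc, hu⟩
    exact hZ r c hc.1 hu
  · intro hr
    obtain ⟨c, hc, hu⟩ := exists_root (M := M) (t := t) hr
    exact ⟨hn hr, c, mem_range.1 (hn hc.1), hc, hu⟩

theorem downClosed_below (n c : ℕ) : DownClosed M t (below M n (t + 1) c) := by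
  intro r d hd hu
  simp only [below, mem_filter, mem_range] at hd ⊢
  exact ⟨hu.le.trans_lt hd.1, Relation.ReflTransGen.trans (hu.mono (Nat.le_succ t)) hd.2⟩

open Classical in
/-- If the rows of column `t` are removed, the rows above them in the forest are removed as well,
since by Γ-freeness a column before `t` leads from a row of column `t` only to later rows of `t`. -/
theorem DownClosed.filter (hM : GammaFree M) {Z : Finset ℕ} (hZ : DownClosed M t Z) :
    DownClosed M t {r ∈ Z | ¬ M r t} := by
  have key : ∀ r c, Up M t r c → M r t → M c t := by
    intro r c hu hr
    induction hu with
    | refl => exact hr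
    | tail _ hs ih =>
      obtain ⟨hlt, j, hj, h1, h2⟩ := hs
      exact hM _ _ j t hlt hj h1 ih h2
  intro r c hc hu
  rw [mem_filter] at hc ⊢
  exact ⟨hZ r c hc.1 hu, fun h => hc.2 (key r c hu h)⟩

end BW

/-! ### Doubly lexical orderings -/

namespace BW

open Finset

/-- Comparison of binary expansions: the largest number in exactly one of two sets decides. -/
theorem exists_last_diff {s t : Finset ℕ} (h : ∑ k ∈ s, 2 ^ k ≤ ∑ k ∈ t, 2 ^ k) {j : ℕ}
    (hs : j ∈ s) (ht : j ∉ t) :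
    ∃ j' > j, j' ∈ t ∧ j' ∉ s ∧ ∀ y > j', (y ∈ s ↔ y ∈ t) := by
  rw [geomSum_le_geomSum_iff_toColex_le_toColex le_rfl,
    Colex.toColex_le_toColex_iff_max'_mem] at h
  have hne : s ≠ t := fun e => ht (e ▸ hs)
  have hmax := h hne
  set m := (symmDiff s t).max' (symmDiff_nonempty.2 hne) with hm
  have hmem : m ∈ symmDiff s t := max'_mem _ _
  refine ⟨m, lt_of_le_of_ne (le_max' _ _ (by rw [mem_symmDiff]; exact Or.inl ⟨hs, ht⟩)) ?_, hmax,
    ?_, fun y hy => ?_⟩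
  · rintro rfl; exact ht hmax
  · rw [mem_symmDiff] at hmem; tauto
  · by_contra hn
    have : y ≤ m := le_max' _ _ (by rw [mem_symmDiff]; tauto)
    omega

/-- The rows of `B` are in lexicographic order, the last columns being most significant, as far as
rows before `p` are concerned. -/
def LexRows (B : ℕ → ℕ → Prop) (p : ℕ) : Prop :=
  ∀ i i' j, i < i' → i' < p → B i j → ¬ B i' j →
    ∃ j' > j, B i' j' ∧ ¬ B i j' ∧ ∀ y > j', (B i y ↔ B i' y)

/-- Rows `r 0, …, r t` and columns `c 0, …, c t` form a zigzag
`… r 2 - c 1 - r 0 - c 0 - r 1 - c 2 …`, whose two ends `r t` and `c t` are incident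
if and only if `closed` holds. -/
def Zigzag (B : ℕ → ℕ → Prop) (t : ℕ) (r c : ℕ → ℕ) (closed : Prop) : Prop :=
  ∀ a ≤ t, ∀ b ≤ t, (B (r a) (c b) ↔ (a = b ∧ (a = 0 ∨ a = t ∧ closed)) ∨ a + 1 = b ∨ b + 1 = a)

/-- One half of the growth of a zigzag: the rows `r (t - 1)` and `r t` differ in column `c t`, so by
the order of the rows they differ the other way round in a later column `c'`, which contains `r t`.
The other rows agree with their successors beyond, so `c'` contains none of them. -/
theorem exists_zigzag_column {B : ℕ → ℕ → Prop} {p t : ℕ} {r c : ℕ → ℕ} (hB : LexRows B p)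
    (ht : 1 ≤ t) (hr : r (t - 1) < r t) (hp : r t < p) (hc : ∀ a < t, c a < c t)
    (hz : Zigzag B t r c False)
    (hag : ∀ s, s + 2 ≤ t → ∀ y > c (s + 2), (B (r s) y ↔ B (r (s + 1)) y)) :
    ∃ c', c t < c' ∧ (∀ a ≤ t, (B (r a) c' ↔ a = t)) ∧
      ∀ y > c', (B (r (t - 1)) y ↔ B (r t) y) := by
  obtain ⟨c', hlt, h1, h2, h3⟩ := hB (r (t - 1)) (r t) (c t) hr hp
    ((hz _ (by omega) _ le_rfl).2 (by omega)) (fun h => by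
      have := (hz _ le_rfl _ le_rfl).1 h
      simp only [and_false, or_false] at this
      omega)
  refine ⟨c', hlt, fun a ha => ?_, h3⟩
  have key : ∀ l a, a + 1 + l = t → ¬ B (r a) c' := by
    intro l
    induction l with
    | zero => intro a ha; rwa [show a = t - 1 by omega]
    | succ l ih =>
      intro a ha
      have : c (a + 2) < c' := by
        rcases Nat.lt_or_ge (a + 2) t with h | h
        · exact (hc _ h).trans hlt
        · rwa [show a + 2 = t by omega]
      rw [hag a (by omega) c' this]
      exact ih (a + 1) (by omega)
  constructor
  · intro h
    by_contra hne
    exact key (t - a - 1) a (by omega) h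
  · rintro rfl; exact h1

/-- A Γ in a doubly lexically ordered matrix grows to a zigzag of any length, as long as it cannot
close up. The two conditions on agreement beyond the last columns and rows keep the growth going. -/
theorem exists_zigzag {B : ℕ → ℕ → Prop} {p q : ℕ} (hp : ∀ i j, B i j → i < p)
    (hq : ∀ i j, B i j → j < q) (hB : LexRows B p) (hB' : LexRows (fun j i => B i j) q)
    (hno : ∀ t ≥ 2, ∀ r c : ℕ → ℕ, (∀ b ≤ t, ∀ a < b, r a < r b) → (∀ b ≤ t, ∀ a < b, c a < c b) →
      ¬ Zigzag B t r c True)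
    {i i' j j' : ℕ} (hi : i < i') (hj : j < j') (h1 : B i j) (h2 : B i j') (h3 : B i' j)
    (h4 : ¬ B i' j') (t : ℕ) (ht : 1 ≤ t) :
    ∃ r c : ℕ → ℕ, (∀ b ≤ t, ∀ a < b, r a < r b) ∧ (∀ b ≤ t, ∀ a < b, c a < c b) ∧
      Zigzag B t r c False ∧
      (∀ s, s + 2 ≤ t → ∀ y > c (s + 2), (B (r s) y ↔ B (r (s + 1)) y)) ∧
      (∀ s, s + 2 ≤ t → ∀ y > r (s + 2), (B y (c s) ↔ B y (c (s + 1)))) := by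
  induction t, ht using Nat.le_induction with
  | base =>
    refine ⟨fun a => if a = 0 then i else i', fun a => if a = 0 then j else j', ?_, ?_, ?_,
      fun s hs => by omega, fun s hs => by omega⟩
    · intro b hb a ha
      simpa only [if_pos (show a = 0 by omega), if_neg (show b ≠ 0 by omega)] using hi
    · intro b hb a ha
      simpa only [if_pos (show a = 0 by omega), if_neg (show b ≠ 0 by omega)] using hj
    · intro a ha b hb
      have ha : a = 0 ∨ a = 1 := by omega
      have hb : b = 0 ∨ b = 1 := by omega
      rcases ha with rfl | rfl <;> rcases hb with rfl | rfl <;> simp [h1, h2, h3, h4]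
  | succ t ht ih =>
    obtain ⟨r, c, hr, hc, hz, hag, hag'⟩ := ih
    have hz' : Zigzag (fun j i => B i j) t c r False := by
      intro a ha b hb
      simp only [hz b hb a ha, and_false, or_false]
      omega
    obtain ⟨c', hlt, hc1, hc2⟩ := exists_zigzag_column hB ht (hr t le_rfl _ (by omega))
      (hp _ (c (t - 1)) ((hz _ le_rfl _ (by omega)).2 (by omega))) (hc t le_rfl) hz hag
    obtain ⟨r', hlt', hr1, hr2⟩ := exists_zigzag_column hB' ht (hc t le_rfl _ (by omega))
      (hq (r (t - 1)) _ ((hz _ (by omega) _ le_rfl).2 (by omega))) (hr t le_rfl) hz' hag'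
    have er : ∀ a ≤ t, Function.update r (t + 1) r' a = r a := fun a ha =>
      Function.update_of_ne (by omega) _ _
    have ec : ∀ a ≤ t, Function.update c (t + 1) c' a = c a := fun a ha =>
      Function.update_of_ne (by omega) _ _
    have mono : ∀ (f : ℕ → ℕ) (x : ℕ), (∀ b ≤ t, ∀ a < b, f a < f b) → f t < x →
        ∀ b ≤ t + 1, ∀ a < b, Function.update f (t + 1) x a < Function.update f (t + 1) x b := by
      intro f x hf hx b hb a ha
      rw [Function.update_of_ne (show a ≠ t + 1 by omega)]
      rcases Nat.lt_or_ge b (t + 1) with h | h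
      · rw [Function.update_of_ne (by omega)]; exact hf b (by omega) a ha
      · rw [show b = t + 1 by omega, Function.update_self]
        rcases Nat.lt_or_ge a t with h | h
        · exact (hf t le_rfl a h).trans hx
        · rwa [show a = t by omega]
    have hmr := mono r r' hr hlt'
    have hmc := mono c c' hc hlt
    have hzz : ∀ cl : Prop, (B r' c' ↔ cl) → Zigzag B (t + 1) (Function.update r (t + 1) r')
        (Function.update c (t + 1) c') cl := by
      intro cl hcl a ha b hb
      rcases Nat.lt_or_ge a (t + 1) with ha' | ha' <;> rcases Nat.lt_or_ge b (t + 1) with hb' | hb'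
      · rw [er a (by omega), ec b (by omega), hz a (by omega) b (by omega)]
        simp only [and_false, or_false]
        have : a ≠ t + 1 := by omega
        simp [this]
      · obtain rfl : b = t + 1 := by omega
        rw [er a (by omega), Function.update_self, hc1 a (by omega)]
        omega
      · obtain rfl : a = t + 1 := by omega
        rw [ec b (by omega), Function.update_self, hr1 b (by omega)]
        omega
      · obtain rfl : a = t + 1 := by omega
        obtain rfl : b = t + 1 := by omega
        rw [Function.update_self, Function.update_self, hcl]
        simp
    have hopen : ¬ B r' c' := fun h => hno (t + 1) (by omega) _ _ hmr hmc (hzz True (by simp [h]))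
    refine ⟨_, _, hmr, hmc, hzz False (by simp [hopen]), ?_, ?_⟩
    · intro s hs y hy
      rw [er s (by omega), er (s + 1) (by omega)]
      rcases Nat.lt_or_ge (s + 1) t with h | h
      · rw [ec _ (by omega)] at hy
        exact hag s (by omega) y hy
      · obtain rfl : t = s + 1 := by omega
        rw [Function.update_self] at hy
        exact hc2 y hy
    · intro s hs y hy
      rw [ec s (by omega), ec (s + 1) (by omega)]
      rcases Nat.lt_or_ge (s + 1) t with h | h
      · rw [er _ (by omega)] at hy
        exact hag' s (by omega) y hy
      · obtain rfl : t = s + 1 := by omega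
        rw [Function.update_self] at hy
        exact hr2 y hy

/-- A doubly lexically ordered matrix without cycles is Γ-free. -/
theorem gammaFree_of_lexRows {B : ℕ → ℕ → Prop} {p q : ℕ} (hp : ∀ i j, B i j → i < p)
    (hq : ∀ i j, B i j → j < q) (hB : LexRows B p) (hB' : LexRows (fun j i => B i j) q)
    (hno : ∀ t ≥ 2, ∀ r c : ℕ → ℕ, (∀ b ≤ t, ∀ a < b, r a < r b) → (∀ b ≤ t, ∀ a < b, c a < c b) →
      ¬ Zigzag B t r c True) : GammaFree B := by
  intro i i' j j' hi hj h1 h2 h3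
  by_contra h4
  obtain ⟨r, c, hr, -, hz, -⟩ := exists_zigzag hp hq hB hB' hno hi hj h1 h2 h3 h4 (p + 1) (by omega)
  have hle : ∀ a ≤ p + 1, a ≤ r a := by
    intro a
    induction a with
    | zero => simp
    | succ a ih => intro ha; have := hr (a + 1) ha a (by omega); have := ih (by omega); omega
  have := hp _ _ ((hz (p + 1) le_rfl p (by omega)).2 (by omega))
  have := hle (p + 1) le_rfl
  omega

/-- The rearrangement inequality, in the form that an optimal arrangement is sorted. -/
theorem le_of_forall_perm_sum_le {p : ℕ} (g : Fin p → ℕ)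
    (h : ∀ π : Equiv.Perm (Fin p), ∑ k, 2 ^ (π k : ℕ) * g k ≤ ∑ k : Fin p, 2 ^ (k : ℕ) * g k)
    {i i' : Fin p} (hi : i < i') : g i ≤ g i' := by
  have h := h (Equiv.swap i i')
  zify at h
  rw [← sub_nonpos, ← sum_sub_distrib, sum_eq_add i i' hi.ne] at h
  · simp only [Equiv.swap_apply_left, Equiv.swap_apply_right] at h
    have hpow : (2 : ℤ) ^ (i : ℕ) < 2 ^ (i' : ℕ) := pow_lt_pow_right₀ (by norm_num) hi
    zify
    by_contra! hlt
    nlinarith [mul_pos (sub_pos.2 hpow) (sub_pos.2 hlt)]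
  · intro k _ hk
    rw [Equiv.swap_apply_of_ne_of_ne hk.1 hk.2, sub_self]
  · simp
  · simp

open Classical in
theorem lexRows_of_maximal {X Y : Type*} [Fintype X] [Fintype Y] (A : X → Y → Prop) {p q : ℕ}
    (e : X ≃ Fin p) (f : Y ≃ Fin q)
    (h : ∀ e' : X ≃ Fin p, ∑ x, ∑ y, (if A x y then 2 ^ (e' x : ℕ) * 2 ^ (f y : ℕ) else 0) ≤
      ∑ x, ∑ y, if A x y then 2 ^ (e x : ℕ) * 2 ^ (f y : ℕ) else 0) :
    LexRows (fun i j => ∃ x y, (e x : ℕ) = i ∧ (f y : ℕ) = j ∧ A x y) p := by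
  set s : X → Finset ℕ := fun x => ({y | A x y} : Finset Y).image fun y => (f y : ℕ) with hs
  have hsum : ∀ e' : X ≃ Fin p,
      ∑ x, ∑ y, (if A x y then 2 ^ (e' x : ℕ) * 2 ^ (f y : ℕ) else 0) =
        ∑ x, 2 ^ (e' x : ℕ) * ∑ k ∈ s x, 2 ^ k := by
    intro e'
    refine sum_congr rfl fun x _ => ?_
    rw [hs, sum_image (fun a _ b _ hab => f.injective (Fin.ext hab)), mul_sum, sum_filter]
  intro i i' j hlt hi' hij hij'
  have hle : ∑ k ∈ s (e.symm ⟨i, hlt.trans hi'⟩), 2 ^ k ≤ ∑ k ∈ s (e.symm ⟨i', hi'⟩), 2 ^ k := by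
    refine le_of_forall_perm_sum_le (fun k => ∑ l ∈ s (e.symm k), 2 ^ l) (fun π => ?_)
      (i := ⟨i, hlt.trans hi'⟩) (i' := ⟨i', hi'⟩) (by simpa using hlt)
    have := h (e.trans π)
    rw [hsum, hsum, ← e.symm.sum_comp, ← e.symm.sum_comp (fun x => 2 ^ (e x : ℕ) * _)] at this
    simpa using this
  have hmem : ∀ (l : ℕ) (hl : l < p) (k : ℕ), k ∈ s (e.symm ⟨l, hl⟩) ↔
      ∃ x y, (e x : ℕ) = l ∧ (f y : ℕ) = k ∧ A x y := by
    intro l hl k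
    simp only [hs, mem_image, mem_filter, mem_univ, true_and]
    constructor
    · rintro ⟨y, hy, rfl⟩
      exact ⟨_, y, by simp, rfl, hy⟩
    · rintro ⟨x, y, rfl, rfl, hA⟩
      exact ⟨y, by simpa using hA, rfl⟩
  obtain ⟨j', hj', h1, h2, h3⟩ := exists_last_diff hle (j := j) ((hmem _ _ _).2 hij)
    (fun h => hij' ((hmem _ _ _).1 h))
  refine ⟨j', hj', (hmem _ _ _).1 h1, fun h => h2 ((hmem _ _ _).2 h), fun y hy => ?_⟩
  simpa only [hmem] using h3 y hy

/-- Every matrix has a doubly lexical ordering: one that maximizes the sum of the weights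
`2 ^ i * 2 ^ j` of its ones. -/
theorem exists_doubly_lex {X Y : Type*} [Fintype X] [Fintype Y] (A : X → Y → Prop) :
    ∃ (e : X ≃ Fin (Fintype.card X)) (f : Y ≃ Fin (Fintype.card Y)),
      LexRows (fun i j => ∃ x y, (e x : ℕ) = i ∧ (f y : ℕ) = j ∧ A x y) (Fintype.card X) ∧
      LexRows (fun j i => ∃ x y, (e x : ℕ) = i ∧ (f y : ℕ) = j ∧ A x y) (Fintype.card Y) := by
  classical
  have : Nonempty ((X ≃ Fin (Fintype.card X)) × (Y ≃ Fin (Fintype.card Y))) :=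
    ⟨(Fintype.equivFin X, Fintype.equivFin Y)⟩
  obtain ⟨⟨e, f⟩, hmax⟩ := Finite.exists_max
    fun ef : (X ≃ Fin (Fintype.card X)) × (Y ≃ Fin (Fintype.card Y)) =>
      ∑ x, ∑ y, if A x y then 2 ^ (ef.1 x : ℕ) * 2 ^ (ef.2 y : ℕ) else 0
  refine ⟨e, f, lexRows_of_maximal A e f fun e' => hmax (e', f), ?_⟩
  have := lexRows_of_maximal (fun y x => A x y) f e fun f' => by
    have := hmax (e, f')
    simp only at this
    rw [sum_comm, sum_comm (s := univ) (t := univ) (f := fun y x => if A x y then _ else _)]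
    simpa only [mul_comm] using this
  convert this using 3 with j i
  rw [exists_comm]
  refine exists_congr fun y => exists_congr fun x => ?_
  tauto

end BW

/-! ### Strongly chordal graphs -/

namespace BW

open Finset

variable {V : Type*} {G : SimpleGraph V}

theorem cycleGraph_adj_iff_val {l : ℕ} (hl : 3 ≤ l) (u v : Fin l) :
    (SimpleGraph.cycleGraph l).Adj u v ↔ (u : ℕ) + 1 = v ∨ (v : ℕ) + 1 = u ∨
      ((u : ℕ) = 0 ∧ (v : ℕ) + 1 = l) ∨ ((v : ℕ) = 0 ∧ (u : ℕ) + 1 = l) := by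
  have key : ∀ a b : Fin l,
      (a - b).val = 1 ↔ (b : ℕ) + 1 = a ∨ ((a : ℕ) = 0 ∧ (b : ℕ) + 1 = l) := by
    intro a b
    have ha := a.2
    have hb := b.2
    rw [Fin.sub_def]
    simp only
    rcases le_or_gt (b : ℕ) a with h | h
    · rw [show l - (b : ℕ) + a = (a - b) + l by omega, Nat.add_mod_right,
        Nat.mod_eq_of_lt (by omega)]
      omega
    · rw [Nat.mod_eq_of_lt (by omega)]
      omega
  rw [SimpleGraph.cycleGraph_adj', key, key]
  tauto

/-- In a chordal graph, two nonadjacent neighbours of `z` are not joined by a walk that otherwise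
avoids `z` and its neighbours: a shortest one would form an induced cycle with `z`. The walk is
given by a sequence in which consecutive vertices are equal or adjacent. -/
theorem IsChordal.not_bypass (hG : IsChordal G) {z : V} (l : ℕ) (p : ℕ → V)
    (h0 : G.Adj z (p 0)) (hl : G.Adj z (p l)) (hne : p 0 ≠ p l) (hna : ¬ G.Adj (p 0) (p l))
    (hp : ∀ i < l, G.Adj (p i) (p (i + 1)) ∨ p i = p (i + 1))
    (hz : ∀ i, 0 < i → i < l → p i ≠ z ∧ ¬ G.Adj z (p i)) : False := by
  induction l using Nat.strong_induction_on generalizing p with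
  | _ l ih =>
    have hl2 : 2 ≤ l := by
      by_contra hlt
      have : l = 0 ∨ l = 1 := by omega
      rcases this with rfl | rfl
      · exact hne rfl
      · rcases hp 0 one_pos with h | h
        · exact hna h
        · exact hne h
    -- cutting out the part of the walk between the positions `i` and `i + d`
    have cut : ∀ i d, 0 < d → i + d ≤ l → (i + d = l ∨ G.Adj (p i) (p (i + d + 1)) ∨
        p i = p (i + d + 1)) → (i + d = l → p i = p l) → False := by
      intro i d hd hid hadj hend
      have hfirst : (if 0 ≤ i then p 0 else p (0 + d)) = p 0 := if_pos (Nat.zero_le _)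
      have hlast : (if l - d ≤ i then p (l - d) else p (l - d + d)) = p l := by
        split_ifs with h
        · rw [show l - d = i by omega]; exact hend (by omega)
        · rw [show l - d + d = l by omega]
      refine ih (l - d) (by omega) (fun k => if k ≤ i then p k else p (k + d)) ?_ ?_ ?_ ?_ ?_ ?_
      · simpa only [hfirst] using h0
      · simpa only [hlast] using hl
      · simpa only [hfirst, hlast] using hne
      · simpa only [hfirst, hlast] using hna
      · intro k hk
        rcases lt_trichotomy k i with h | rfl | h
        · simp only [if_pos h.le, if_pos (show k + 1 ≤ i from h)]
          exact hp k (by omega)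
        · simp only [le_refl, if_true, if_neg (show ¬ k + 1 ≤ k by omega)]
          rw [show k + 1 + d = k + d + 1 by ring]
          rcases hadj with h | h
          · omega
          · exact h
        · simp only [if_neg (show ¬ k ≤ i by omega), if_neg (show ¬ k + 1 ≤ i by omega)]
          rw [show k + 1 + d = k + d + 1 by ring]
          exact hp (k + d) (by omega)
      · intro k hk hk'
        split_ifs with h
        · exact hz k hk (by omega)
        · exact hz (k + d) (by omega) (by omega)
    have hinj : ∀ i j, i < j → j ≤ l → p i ≠ p j := by
      intro i j hij hj he
      refine cut i (j - i) (by omega) (by omega) ?_ ?_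
      · rcases hj.eq_or_lt with rfl | h
        · exact Or.inl (by omega)
        · right
          rw [show i + (j - i) = j by omega, he]
          exact hp j h
      · intro h
        rw [he, show j = l by omega]
    have hind : ∀ i j, i < j → j ≤ l → (G.Adj (p i) (p j) ↔ i + 1 = j) := by
      intro i j hij hj
      constructor
      · intro hadj
        by_contra hne'
        refine cut i (j - i - 1) (by omega) (by omega) ?_ (fun h => by omega)
        rw [show i + (j - i - 1) + 1 = j by omega]
        exact Or.inr (Or.inl hadj)
      · rintro rfl
        exact (hp i (by omega)).resolve_right (hinj i (i + 1) hij hj)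
    have hpz : ∀ i ≤ l, p i ≠ z := by
      intro i hi
      rcases Nat.eq_zero_or_pos i with rfl | h
      · exact h0.ne'
      · rcases hi.eq_or_lt with rfl | h'
        · exact hl.ne'
        · exact (hz i h h').1
    have hzadj : ∀ i ≤ l, (G.Adj z (p i) ↔ i = 0 ∨ i = l) := by
      intro i hi
      constructor
      · intro h
        by_contra hne'
        exact (hz i (by omega) (by omega)).2 h
      · rintro (rfl | rfl)
        · exact h0
        · exact hl
    let f : Fin (l + 2) → V := fun i => if (i : ℕ) ≤ l then p i else z
    have hf : ∀ i j : Fin (l + 2), i < j → f i ≠ f j ∧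
        (G.Adj (f i) (f j) ↔ (SimpleGraph.cycleGraph (l + 2)).Adj i j) := by
      intro i j hij
      have hij' : (i : ℕ) < j := hij
      have hj := j.2
      rw [cycleGraph_adj_iff_val (by omega)]
      simp only [f, if_pos (show (i : ℕ) ≤ l by omega)]
      split_ifs with h
      · exact ⟨hinj _ _ hij' h, by rw [hind _ _ hij' h]; omega⟩
      · exact ⟨hpz _ (by omega), by rw [G.adj_comm, hzadj _ (by omega)]; omega⟩
    refine (hG (l + 2) (by omega)).false ⟨⟨f, ?_⟩, ?_⟩
    · intro i j he
      rcases lt_trichotomy i j with h | h | h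
      · exact absurd he (hf i j h).1
      · exact h
      · exact absurd he.symm (hf j i h).1
    · intro i j
      change G.Adj (f i) (f j) ↔ _
      rcases lt_trichotomy i j with h | rfl | h
      · exact (hf i j h).2
      · simp
      · rw [G.adj_comm, SimpleGraph.adj_comm _ i]; exact (hf j i h).2

/-- A strongly chordal graph has no closed sequence of even length at least six in which positions
at an odd cyclic distance hold equal or adjacent vertices exactly if this distance is one, while
different positions at an even distance hold different vertices. The sequence is extended
periodically. -/
theorem IsStronglyChordal.not_cyclic (hG : IsStronglyChordal G) {l : ℕ} (hl : 6 ≤ l) (he : Even l)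
    (F : ℕ → V) (hper : ∀ i, F (i + l) = F i)
    (hinj : ∀ i d, Even d → 0 < d → d < l → F i ≠ F (i + d))
    (hadj : ∀ i, G.Adj (F i) (F (i + 1)) ∨ F i = F (i + 1))
    (hno : ∀ i d, Odd d → 1 < d → d + 1 < l → F i ≠ F (i + d) ∧ ¬ G.Adj (F i) (F (i + d))) :
    False := by
  by_cases hcol : ∃ m, F m = F (m + 1)
  · -- Two neighbouring positions hold the same vertex `z`, which the rest of the cycle bypasses.
    obtain ⟨m, hm⟩ := hcol
    have e1 : F (m + 2 + (l - 3)) = F (m + (l - 1)) := by congr 1; omega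
    have ho3 : Odd (l - 3) := by
      rcases he with ⟨r, hr⟩
      exact ⟨r - 2, by omega⟩
    have hA := hno (m + 2) (l - 3) ho3 (by omega) (by omega)
    refine hG.1.not_bypass (z := F (m + 1)) (l - 3) (fun k => F (m + 2 + k)) ?_ ?_ hA.1 hA.2 ?_ ?_
    · refine (hadj (m + 1)).resolve_right fun h => ?_
      exact hinj m 2 (by decide) (by omega) (by omega) (hm.trans h)
    · rw [e1]
      have h1 := hadj (m + (l - 1))
      rw [show m + (l - 1) + 1 = m + l by omega, hper, hm] at h1
      rcases h1 with h1 | h1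
      · exact h1.symm
      · refine absurd h1.symm ?_
        rw [show m + (l - 1) = m + 1 + (l - 2) by omega]
        exact hinj _ _ ((Nat.even_sub (by omega)).2 (by simp [he])) (by omega) (by omega)
    · intro i _
      exact hadj _
    · intro k hk hk'
      rcases Nat.even_or_odd k with h | h
      · have := hno (m + 1) (1 + k) (by rw [add_comm]; exact h.add_one) (by omega) (by omega)
        rw [show m + 1 + (1 + k) = m + 2 + k by ring] at this
        exact ⟨this.1.symm, this.2⟩
      · have := hno m (2 + k) (Even.add_odd (by decide) h) (by omega) (by omega)
        rw [show m + (2 + k) = m + 2 + k by ring, hm] at this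
        exact ⟨this.1.symm, this.2⟩
  · -- The sequence is a cycle of the graph, whose odd chord contradicts `hno`.
    push Not at hcol
    have hFinj : ∀ i j, i < j → j < l → F i ≠ F j := by
      intro i j hij hj
      rcases Nat.even_or_odd (j - i) with h | h
      · have := hinj i (j - i) h (by omega) (by omega)
        rwa [show i + (j - i) = j by omega] at this
      · by_cases h1 : j - i = 1
        · rw [show j = i + 1 by omega]; exact hcol i
        · rcases Nat.lt_or_ge (j - i + 1) l with h2 | h2
          · have := (hno i (j - i) h (by have := h.pos; omega) h2).1
            rwa [show i + (j - i) = j by omega] at this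
          · have := hcol j
            rw [show j + 1 = 0 + l by omega, hper, show 0 = i by omega] at this
            exact this.symm
    obtain ⟨n, rfl⟩ : ∃ n, l = n + 3 := ⟨l - 3, by omega⟩
    have hadj' : ∀ i, G.Adj (F i) (F (i + 1)) := fun i => (hadj i).resolve_right (hcol i)
    have hF0 : F (n + 3) = F 0 := by rw [← hper 0, Nat.zero_add]
    let f : SimpleGraph.cycleGraph (n + 3) →g G :=
      ⟨fun i => F i, by
        intro u v huv
        rw [cycleGraph_adj_iff_val (by omega)] at huv
        rcases huv with h | h | h | h
        · rw [← h]; exact hadj' _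
        · rw [← h]; exact (hadj' _).symm
        · have := hadj' v
          rw [h.2, hF0, ← h.1] at this
          exact this.symm
        · have := hadj' u
          rwa [h.2, hF0, ← h.1] at this⟩
    have hf : Function.Injective f := by
      intro u v huv
      rcases lt_trichotomy u v with h | h | h
      · exact absurd huv (hFinj u v h v.2)
      · exact h
      · exact absurd huv.symm (hFinj v u h u.2)
    have hlen : ((SimpleGraph.cycleGraph.cycle n).map f).length = n + 3 := by simp
    have hvert : ∀ i ≤ n + 3, ((SimpleGraph.cycleGraph.cycle n).map f).getVert i =
        F (n + 3 - i) := by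
      intro i hi
      rw [SimpleGraph.Walk.getVert_map, SimpleGraph.cycleGraph.getVert_cycle hi]
      change F ((n + 3 - i) % (n + 3)) = _
      rcases Nat.eq_zero_or_pos i with rfl | h
      · rw [Nat.sub_zero, Nat.mod_self, ← hper, Nat.zero_add]
      · rw [Nat.mod_eq_of_lt (by omega)]
    obtain ⟨i, j, hij, hj, h1, h2, h3⟩ := hG.2 _ ((SimpleGraph.cycleGraph.cycle n).map f)
      ((SimpleGraph.Walk.isCycle_map_iff_of_injective hf).2
        SimpleGraph.cycleGraph.isCycle_cycle) (by rwa [hlen]) (by rwa [hlen])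
    rw [hlen] at hj h1 h2
    rw [hvert i (by omega), hvert j (by omega)] at h3
    have ho : Odd (j - i) := by
      rcases min_choice (j - i) (n + 3 - (j - i)) with h | h
      · rwa [h] at h2
      · rw [h] at h2
        by_contra hn
        rw [Nat.not_odd_iff_even] at hn
        exact Nat.not_even_iff_odd.2 h2 ((Nat.even_sub (by omega)).2 (by simp [hn, he]))
    have := (hno (n + 3 - j) (j - i) ho (by omega) (by omega)).2
    rw [show n + 3 - j + (j - i) = n + 3 - i by omega] at this
    exact this h3.symm

/-- The closed neighbourhood matrix of a strongly chordal graph has no cycles: rows `x a` and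
columns `y a` cannot form a zigzag whose ends `x t` and `y t` are incident. -/
theorem IsStronglyChordal.not_closed_zigzag (hG : IsStronglyChordal G) {t : ℕ} (ht : 2 ≤ t)
    (x y : ℕ → V) (hx : ∀ a ≤ t, ∀ b ≤ t, x a = x b → a = b)
    (hy : ∀ a ≤ t, ∀ b ≤ t, y a = y b → a = b)
    (hxy : ∀ a ≤ t, ∀ b ≤ t, (x a = y b ∨ G.Adj (x a) (y b) ↔
      (a = b ∧ (a = 0 ∨ a = t)) ∨ a + 1 = b ∨ b + 1 = a)) : False := by
  -- Position `p` of the closed zigzag is the row or column, depending on parity, of index `ix p`.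
  let ix : ℕ → ℕ := fun p => if p ≤ t then p else 2 * t + 1 - p
  let cyc : ℕ → V := fun p => if Even p then x (ix p) else y (ix p)
  have hix : ∀ p < 2 * t + 2, ix p ≤ t := by
    intro p hp
    simp only [ix]
    split_ifs <;> omega
  have hmod : ∀ i d, d < 2 * t + 2 → i % (2 * t + 2) < 2 * t + 2 ∧
      (i + d) % (2 * t + 2) < 2 * t + 2 ∧
      ((i + d) % (2 * t + 2) = i % (2 * t + 2) + d ∨
        (i + d) % (2 * t + 2) + (2 * t + 2) = i % (2 * t + 2) + d) := by
    intro i d hd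
    have h := Nat.mod_lt i (show 0 < 2 * t + 2 by omega)
    refine ⟨h, Nat.mod_lt _ (by omega), ?_⟩
    rw [Nat.add_mod, Nat.mod_eq_of_lt hd]
    rcases Nat.lt_or_ge (i % (2 * t + 2) + d) (2 * t + 2) with h' | h'
    · exact Or.inl (Nat.mod_eq_of_lt h')
    · right
      rw [Nat.mod_eq_sub_mod h', Nat.mod_eq_of_lt (by omega)]
      omega
  have hinc : ∀ p q, p < 2 * t + 2 → q < 2 * t + 2 → Even p → Odd q →
      (x (ix p) = y (ix q) ∨ G.Adj (x (ix p)) (y (ix q)) ↔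
        p + 1 = q ∨ q + 1 = p ∨ (p = 0 ∧ q + 1 = 2 * t + 2)) := by
    rintro p q hp hq ⟨u, hu⟩ ⟨v, hv⟩
    rw [hxy _ (hix p hp) _ (hix q hq)]
    simp only [ix]
    split_ifs <;> omega
  -- The incidences between two positions of different parity.
  have hnb : ∀ p q, p < 2 * t + 2 → q < 2 * t + 2 → Odd (p + q) →
      (cyc p = cyc q ∨ G.Adj (cyc p) (cyc q) ↔
        p + 1 = q ∨ q + 1 = p ∨ (p = 0 ∧ q + 1 = 2 * t + 2) ∨ (q = 0 ∧ p + 1 = 2 * t + 2)) := by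
    intro p q hp hq hodd
    rcases Nat.even_or_odd p with h | h
    · have h' : Odd q := by rwa [Nat.odd_add', iff_true_right h] at hodd
      have := hinc p q hp hq h h'
      simp only [cyc, if_pos h, if_neg (Nat.not_even_iff_odd.2 h'), this]
      rcases h' with ⟨v, hv⟩
      omega
    · have h' : Even q := by rwa [Nat.odd_add, iff_true_left h] at hodd
      have := hinc q p hq hp h' h
      rw [eq_comm, G.adj_comm]
      simp only [cyc, if_pos h', if_neg (Nat.not_even_iff_odd.2 h), this]
      rcases h with ⟨v, hv⟩
      omega
  have hpar : ∀ i d, d < 2 * t + 2 → (Even (i % (2 * t + 2) + (i + d) % (2 * t + 2)) ↔ Even d) := by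
    intro i d hd
    obtain ⟨h1, h2, h3⟩ := hmod i d hd
    simp only [Nat.even_iff]
    omega
  refine hG.not_cyclic (l := 2 * t + 2) (by omega) ⟨t + 1, by ring⟩ (fun i => cyc (i % (2 * t + 2)))
    (fun i => by simp) ?_ ?_ ?_
  · intro i d hd hd0 hdl he
    obtain ⟨h1, h2, h3⟩ := hmod i d hdl
    have hp := (hpar i d hdl).2 hd
    have hne : i % (2 * t + 2) ≠ (i + d) % (2 * t + 2) := by omega
    generalize i % (2 * t + 2) = p at *
    generalize (i + d) % (2 * t + 2) = q at *
    simp only [cyc] at he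
    have hix' : ix p ≠ ix q := by
      rcases hp with ⟨u, hu⟩
      simp only [ix]
      split_ifs <;> omega
    rw [Nat.even_add] at hp
    by_cases h : Even p
    · rw [if_pos h, if_pos (hp.1 h)] at he
      exact hix' (hx _ (hix p h1) _ (hix q h2) he)
    · rw [if_neg h, if_neg (fun h' => h (hp.2 h'))] at he
      exact hix' (hy _ (hix p h1) _ (hix q h2) he)
  · intro i
    obtain ⟨h1, h2, h3⟩ := hmod i 1 (by omega)
    rw [or_comm]
    refine (hnb _ _ h1 h2 ?_).2 (by omega)
    rw [← Nat.not_even_iff_odd, hpar i 1 (by omega)]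
    decide
  · intro i d hd hd1 hdl
    obtain ⟨h1, h2, h3⟩ := hmod i d (by omega)
    rw [← not_or, hnb _ _ h1 h2 ?_]
    · omega
    · rw [← Nat.not_even_iff_odd, hpar i d (by omega), Nat.not_even_iff_odd]
      exact hd

/-- Every nonempty set `R` of vertices of a strongly chordal graph has a member `v` such that the
closed neighbourhoods that contain `v` form a chain when restricted to `R`: the first row of a
doubly lexical ordering of the rows in `R`. -/
theorem IsStronglyChordal.exists_nest [Fintype V] (hG : IsStronglyChordal G) (R : Finset V)
    (hR : R.Nonempty) : ∃ v ∈ R, ∀ u u', (v = u ∨ G.Adj v u) → (v = u' ∨ G.Adj v u') →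
      (∀ w ∈ R, (w = u ∨ G.Adj w u) → (w = u' ∨ G.Adj w u')) ∨
      (∀ w ∈ R, (w = u' ∨ G.Adj w u') → (w = u ∨ G.Adj w u)) := by
  let A : R → V → Prop := fun w u => (w : V) = u ∨ G.Adj w u
  obtain ⟨e, f, he, hf⟩ := exists_doubly_lex A
  set B : ℕ → ℕ → Prop := fun i j => ∃ x y, (e x : ℕ) = i ∧ (f y : ℕ) = j ∧ A x y with hB
  have hBA : ∀ x y, B (e x) (f y) ↔ A x y := by
    intro x y
    constructor
    · rintro ⟨x', y', h1, h2, h⟩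
      rwa [e.injective (Fin.ext h1), f.injective (Fin.ext h2)] at h
    · intro h
      exact ⟨x, y, rfl, rfl, h⟩
  have hgamma : GammaFree B := by
    refine gammaFree_of_lexRows (p := Fintype.card R) (q := Fintype.card V) ?_ ?_ he hf ?_
    · rintro i j ⟨x, y, rfl, rfl, -⟩; exact (e x).2
    · rintro i j ⟨x, y, rfl, rfl, -⟩; exact (f y).2
    · intro t ht r c hr hc hz
      have hex : ∀ a ≤ t, (∃ x, (e x : ℕ) = r a) ∧ ∃ y, (f y : ℕ) = c a := by
        intro a ha
        have h1 : ∃ b ≤ t, B (r a) (c b) ∧ B (r b) (c a) := by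
          rcases Nat.eq_zero_or_pos a with rfl | h
          · exact ⟨0, ha, (hz 0 ha 0 ha).2 (by simp), (hz 0 ha 0 ha).2 (by simp)⟩
          · exact ⟨a - 1, by omega, (hz _ ha _ (by omega)).2 (by omega),
              (hz _ (by omega) _ ha).2 (by omega)⟩
        obtain ⟨b, -, ⟨x, y, hx, -, -⟩, ⟨x', y', -, hy', -⟩⟩ := h1
        exact ⟨⟨x, hx⟩, ⟨y', hy'⟩⟩
      have hx : ∀ a, ∃ x : R, a ≤ t → (e x : ℕ) = r a := by
        intro a
        by_cases ha : a ≤ t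
        · obtain ⟨x, hx⟩ := (hex a ha).1
          exact ⟨x, fun _ => hx⟩
        · exact ⟨⟨hR.choose, hR.choose_spec⟩, fun h => absurd h ha⟩
      have hy : ∀ a, ∃ y : V, a ≤ t → (f y : ℕ) = c a := by
        intro a
        by_cases ha : a ≤ t
        · obtain ⟨y, hy⟩ := (hex a ha).2
          exact ⟨y, fun _ => hy⟩
        · exact ⟨hR.choose, fun h => absurd h ha⟩
      choose x hx using hx
      choose y hy using hy
      have inj : ∀ g : ℕ → ℕ, (∀ b ≤ t, ∀ a < b, g a < g b) →
          ∀ a ≤ t, ∀ b ≤ t, g a = g b → a = b := by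
        intro g hg a ha b hb h
        rcases lt_trichotomy a b with h' | h' | h'
        · exact absurd h (hg b hb a h').ne
        · exact h'
        · exact absurd h (hg a ha b h').ne'
      refine hG.not_closed_zigzag ht (fun a => (x a : V)) y ?_ ?_ ?_
      · intro a ha b hb h
        exact inj r hr a ha b hb (by rw [← hx a ha, ← hx b hb, Subtype.ext h])
      · intro a ha b hb h
        exact inj c hc a ha b hb (by rw [← hy a ha, ← hy b hb, h])
      · intro a ha b hb
        have h1 := hBA (x a) (y b)
        have h2 := hz a ha b hb
        rw [hx a ha, hy b hb] at h1
        simp only [and_true] at h2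
        exact h1.symm.trans h2
  have hpos : 0 < Fintype.card R := Fintype.card_pos_iff.2 hR.to_subtype
  set v : R := e.symm ⟨0, hpos⟩ with hv
  have hev : (e v : ℕ) = 0 := by simp [hv]
  -- The first row of a Γ-free matrix has the required property.
  have main : ∀ u u', A v u → A v u' → f u ≤ f u' → ∀ w : R, A w u → A w u' := by
    intro u u' h h' hle w hw
    rcases eq_or_ne w v with rfl | hne
    · exact h'
    rcases hle.eq_or_lt with heq | hlt
    · rwa [← f.injective heq]
    rw [← hBA] at h h' hw ⊢
    rw [hev] at h h'
    refine hgamma 0 (e w) (f u) (f u') ?_ hlt h h' hw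
    rw [Nat.pos_iff_ne_zero]
    intro h0
    exact hne (e.injective (Fin.ext (h0.trans hev.symm)))
  refine ⟨v, v.2, fun u u' h h' => ?_⟩
  rcases le_total (f u) (f u') with hle | hle
  · exact Or.inl fun w hw => main u u' h h' hle ⟨w, hw⟩
  · exact Or.inr fun w hw => main u' u h' h hle ⟨w, hw⟩

end BW

/-! ### The ordered neighbourhood matrix -/

namespace BW

open Finset

/-- The closed neighbourhood relation of a graph on `Fin n`, on natural numbers. -/
def Nb {n : ℕ} (G : SimpleGraph (Fin n)) (u v : ℕ) : Prop :=
  u = v ∨ ∃ i j : Fin n, (i : ℕ) = u ∧ (j : ℕ) = v ∧ G.Adj i j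

theorem nb_val_iff {n : ℕ} (G : SimpleGraph (Fin n)) (u v : Fin n) :
    Nb G u v ↔ u = v ∨ G.Adj u v := by
  constructor
  · rintro (h | ⟨i, j, hi, hj, h⟩)
    · exact Or.inl (Fin.ext h)
    · rw [Fin.ext hi, Fin.ext hj] at h
      exact Or.inr h
  · rintro (rfl | h)
    · exact Or.inl rfl
    · exact Or.inr ⟨u, v, rfl, rfl, h⟩

/-- Vertex `v` can be the next row after `f 0, …, f (i - 1)`: it is not among them, and the closed
neighbourhoods containing it form a chain when restricted to the vertices not among them. -/
def NextRow {n : ℕ} (G : SimpleGraph (Fin n)) (f : ℕ → ℕ) (i v : ℕ) : Prop :=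
  (∀ i' < i, f i' ≠ v) ∧ ∀ u < n, ∀ u' < n, Nb G v u → Nb G v u' →
    (∀ w < n, (∀ i' < i, f i' ≠ w) → Nb G w u → Nb G w u') ∨
    (∀ w < n, (∀ i' < i, f i' ≠ w) → Nb G w u' → Nb G w u)

theorem exists_nextRow {n : ℕ} {G : SimpleGraph (Fin n)} (hG : IsStronglyChordal G) (f : ℕ → ℕ)
    {i : ℕ} (hi : i < n) : ∃ v < n, NextRow G f i v := by
  classical
  set R : Finset (Fin n) := {v | ∀ i' < i, f i' ≠ v} with hR
  have hne : R.Nonempty := by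
    have h : ∃ v ∈ range n, v ∉ (range i).image f := by
      by_contra! h
      have h1 := card_le_card (show range n ⊆ (range i).image f from h)
      have h2 := card_image_le (s := range i) (f := f)
      simp only [card_range] at h1 h2
      omega
    obtain ⟨v, hv, hv'⟩ := h
    refine ⟨⟨v, mem_range.1 hv⟩, ?_⟩
    simp only [mem_image, mem_range, not_exists, not_and] at hv'
    simpa [hR] using hv'
  obtain ⟨v, hv, h⟩ := hG.exists_nest R hne
  have hmem : ∀ w : Fin n, w ∈ R ↔ ∀ i' < i, f i' ≠ w := by simp [hR]
  refine ⟨v, v.2, (hmem v).1 hv, fun u hu u' hu' h1 h2 => ?_⟩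
  refine (h ⟨u, hu⟩ ⟨u', hu'⟩ ((nb_val_iff G v ⟨u, hu⟩).1 h1)
    ((nb_val_iff G v ⟨u', hu'⟩).1 h2)).imp ?_ ?_
  · intro h w hw hwR hwu
    exact (nb_val_iff G ⟨w, hw⟩ ⟨u', hu'⟩).2 (h ⟨w, hw⟩ ((hmem _).2 hwR)
      ((nb_val_iff G ⟨w, hw⟩ ⟨u, hu⟩).1 hwu))
  · intro h w hw hwR hwu
    exact (nb_val_iff G ⟨w, hw⟩ ⟨u, hu⟩).2 (h ⟨w, hw⟩ ((hmem _).2 hwR)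
      ((nb_val_iff G ⟨w, hw⟩ ⟨u', hu'⟩).1 hwu))

/-- The rows are ordered by successive elimination. -/
def RowOrder {n : ℕ} (G : SimpleGraph (Fin n)) (f : ℕ → ℕ) (m : ℕ) : Prop :=
  ∀ i < m, f i < n ∧ NextRow G f i (f i)

open Classical in
/-- A closed neighbourhood as a binary number, vertex `f r` having weight `2 ^ r`. -/
noncomputable def key {n : ℕ} (G : SimpleGraph (Fin n)) (f : ℕ → ℕ) (u : ℕ) : ℕ :=
  ∑ r ∈ range n, if Nb G (f r) u then 2 ^ r else 0

/-- The strict order of the columns: by `key`, ties being broken by the names of the vertices. -/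
def Before (k : ℕ → ℕ) (u u' : ℕ) : Prop := k u < k u' ∨ (k u = k u' ∧ u < u')

theorem not_before_self {k : ℕ → ℕ} {u : ℕ} : ¬ Before k u u := by
  unfold Before
  omega

open Classical in
/-- The number of columns before a given one. -/
noncomputable def rank (n : ℕ) (k : ℕ → ℕ) (u : ℕ) : ℕ := #{u' ∈ range n | Before k u' u}

theorem rank_lt_rank {n : ℕ} {k : ℕ → ℕ} {u u' : ℕ} (hu : u < n) (h : Before k u u') :
    rank n k u < rank n k u' := by
  classical
  unfold rank
  refine card_lt_card (Finset.ssubset_iff_subset_ne.2 ⟨?_, ?_⟩)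
  · intro x hx
    rw [mem_filter] at hx ⊢
    refine ⟨hx.1, ?_⟩
    have := hx.2
    unfold Before at *
    omega
  · intro heq
    have : u ∈ ({x ∈ range n | Before k x u'} : Finset ℕ) := by simp [hu, h]
    rw [← heq, mem_filter] at this
    exact not_before_self this.2

theorem rank_lt {n : ℕ} {k : ℕ → ℕ} {u : ℕ} (hu : u < n) : rank n k u < n := by
  classical
  unfold rank
  refine lt_of_lt_of_eq (card_lt_card (t := range n) ?_) (card_range n)
  refine Finset.ssubset_iff_subset_ne.2 ⟨filter_subset _ _, fun heq => ?_⟩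
  have : u ∈ ({x ∈ range n | Before k x u} : Finset ℕ) := by rw [heq]; exact mem_range.2 hu
  exact not_before_self (mem_filter.1 this).2

theorem rank_injOn (n : ℕ) (k : ℕ → ℕ) : Set.InjOn (rank n k) (range n) := by
  intro u hu u' hu' h
  simp only [coe_range, Set.mem_Iio] at hu hu'
  by_contra hne
  have : Before k u u' ∨ Before k u' u := by unfold Before; omega
  rcases this with h' | h'
  · exact (rank_lt_rank hu h').ne h
  · exact (rank_lt_rank hu' h').ne' h

/-- The columns in their order: `colAt n k j` is the column of rank `j`. -/
noncomputable def colAt (n : ℕ) (k : ℕ → ℕ) (j : ℕ) : ℕ :=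
  ∑ u ∈ range n, if rank n k u = j then u else 0

theorem colAt_spec {n : ℕ} (k : ℕ → ℕ) {j : ℕ} (hj : j < n) :
    colAt n k j < n ∧ rank n k (colAt n k j) = j := by
  classical
  have himg : (range n).image (rank n k) = range n := by
    refine eq_of_subset_of_card_le ?_ ?_
    · intro x hx
      obtain ⟨u, hu, rfl⟩ := mem_image.1 hx
      exact mem_range.2 (rank_lt (mem_range.1 hu))
    · rw [card_image_of_injOn (rank_injOn n k)]
  have : j ∈ (range n).image (rank n k) := by rw [himg]; exact mem_range.2 hj
  obtain ⟨u, hu, rfl⟩ := mem_image.1 this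
  have : colAt n k (rank n k u) = u := by
    unfold colAt
    rw [sum_eq_single u]
    · simp
    · intro u' hu' hne
      rw [if_neg fun h => hne (rank_injOn n k hu' hu h)]
    · exact fun h => absurd hu h
  rw [this]
  exact ⟨mem_range.1 hu, rfl⟩

theorem before_colAt {n : ℕ} (k : ℕ → ℕ) {j j' : ℕ} (hj : j < j') (hj' : j' < n) :
    Before k (colAt n k j) (colAt n k j') := by
  obtain ⟨h1, h2⟩ := colAt_spec k (hj.trans hj')
  obtain ⟨h3, h4⟩ := colAt_spec k hj'
  by_contra hn
  have : Before k (colAt n k j') (colAt n k j) ∨ colAt n k j = colAt n k j' := by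
    unfold Before at hn ⊢; omega
  rcases this with h | h
  · have := rank_lt_rank h3 h
    omega
  · rw [h] at h2; omega

/-- The closed neighbourhood matrix with reordered rows and columns. -/
def orderedMatrix {n : ℕ} (G : SimpleGraph (Fin n)) (f g : ℕ → ℕ) (i j : ℕ) : Prop :=
  i < n ∧ j < n ∧ Nb G (f i) (g j)

/-- Elimination makes any two columns with a common row comparable from that row on, and the
binary order puts the smaller one first. -/
theorem gammaFree_orderedMatrix {n : ℕ} {G : SimpleGraph (Fin n)} {f : ℕ → ℕ}
    (hf : RowOrder G f n) : GammaFree (orderedMatrix G f (colAt n (key G f))) := by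
  classical
  rintro i i' j j' hi hj ⟨hin, hjn, h1⟩ ⟨-, hjn', h2⟩ ⟨hin', -, h3⟩
  refine ⟨hin', hjn', ?_⟩
  have hrem : ∀ i'', i < i'' → i'' < n → ∀ k < i, f k ≠ f i'' := fun i'' h h' k hk =>
    ((hf i'' h').2.1 k (hk.trans h))
  obtain ⟨hfi, hnext⟩ := hf i hin
  have hu := (colAt_spec (key G f) hjn).1
  have hu' := (colAt_spec (key G f) hjn').1
  rcases hnext.2 _ hu _ hu' h1 h2 with h | h
  · exact h _ (hf i' hin').1 (hrem i' hi hin') h3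
  · by_contra hno
    have hkey : ∀ u, key G f u = ∑ r ∈ range n with Nb G (f r) u, 2 ^ r := fun u => by
      rw [key, sum_filter]
    have hle : key G f (colAt n (key G f) j) ≤ key G f (colAt n (key G f) j') := by
      have := before_colAt (key G f) hj hjn'
      unfold Before at this
      omega
    rw [hkey, hkey] at hle
    obtain ⟨i'', hlt, hmem, hnot, -⟩ := exists_last_diff hle (j := i') (by simp [hin', h3])
      (by simp [hno])
    simp only [mem_filter, mem_range, not_and] at hmem hnot
    exact hnot hmem.1 (h _ (hf i'' hmem.1).1 (hrem i'' (hi.trans hlt) hmem.1) hmem.2)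

/-- A coloring with `b` black and `w` white vertices exists if and only if `b` closed neighbourhoods
have a union of at most `n - w` vertices. -/
theorem hasBWColoring_iff {n : ℕ} {G : SimpleGraph (Fin n)} {f g : ℕ → ℕ}
    (hf : ∀ i < n, f i < n) (hfi : ∀ i < n, ∀ i' < i, f i' ≠ f i)
    (hg : ∀ j < n, g j < n) (hgi : ∀ j < n, ∀ j' < j, g j' ≠ g j) (b w : ℕ) :
    HasBWColoring G b w ↔ w ≤ n ∧ b ≤ best (orderedMatrix G f g) (range n) n (n - w) := by
  classical
  have bij : ∀ h : ℕ → ℕ, (∀ i < n, h i < n) → (∀ i < n, ∀ i' < i, h i' ≠ h i) →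
      ∃ e : Fin n ≃ Fin n, ∀ i : Fin n, (e i : ℕ) = h i := by
    intro h h1 h2
    have hinj : Function.Injective fun i : Fin n => (⟨h i, h1 i i.2⟩ : Fin n) := by
      intro i i' he
      simp only [Fin.mk.injEq] at he
      rcases lt_trichotomy i i' with hlt | heq | hlt
      · exact absurd he (h2 i' i'.2 i hlt)
      · exact heq
      · exact absurd he.symm (h2 i i.2 i' hlt)
    exact ⟨Equiv.ofBijective _ (Finite.injective_iff_bijective.1 hinj), fun i => rfl⟩
  obtain ⟨e, he⟩ := bij f hf hfi
  obtain ⟨e', he'⟩ := bij g hg hgi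
  have hM : ∀ i j : Fin n, orderedMatrix G f g i j ↔ e i = e' j ∨ G.Adj (e i) (e' j) := by
    intro i j
    rw [orderedMatrix, ← he, ← he', nb_val_iff]
    simp
  have hfirst : ∀ j : Fin n, ∃ r ∈ range n, First (orderedMatrix G f g) r j := by
    intro j
    have hex : ∃ r, orderedMatrix G f g r j := ⟨e.symm (e' j), (hM _ _).2 (by simp)⟩
    refine ⟨Nat.find hex, mem_range.2 (Nat.find_spec hex).1, Nat.find_spec hex, fun r' hr' =>
      Nat.find_min hex hr'⟩
  constructor
  · rintro ⟨B, W, hdisj, rfl, rfl, hBW⟩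
    have hW : #W ≤ n := by simpa using card_le_univ W
    refine ⟨hW, ?_⟩
    set C : Finset ℕ := ({i | e i ∉ W} : Finset (Fin n)).map Fin.valEmbedding with hC
    have hcard : #C ≤ n - #W := by
      rw [hC, card_map]
      have h1 : #({i | e i ∉ W} : Finset (Fin n)) = #Wᶜ := by
        refine card_bij (fun i _ => e i) ?_ ?_ ?_
        · intro i hi; simpa using hi
        · intro i _ i' _ h; exact e.injective h
        · intro x hx; exact ⟨e.symm x, by simpa using hx, by simp⟩
      rw [h1, card_compl, Fintype.card_fin]
    have hsub : C ⊆ range n := by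
      intro i hi
      simp only [hC, mem_map, Fin.valEmbedding_apply] at hi
      obtain ⟨i, -, rfl⟩ := hi
      exact mem_range.2 i.2
    refine le_trans ?_ (gain_le_best hsub hcard)
    unfold gain
    refine card_le_card_of_injOn (fun x => (e'.symm x : ℕ)) ?_ ?_
    · intro x hx
      simp only [coe_filter, Set.mem_ofPred_eq, mem_range]
      refine ⟨(e'.symm x).2, by simpa using hfirst (e'.symm x), fun r hr hm => ?_⟩
      have := (hM ⟨r, hr⟩ (e'.symm x)).1 hm
      rw [Equiv.apply_symm_apply] at this
      simp only [hC, mem_map, mem_filter, mem_univ, true_and, Fin.valEmbedding_apply]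
      refine ⟨⟨r, hr⟩, fun hW => ?_, rfl⟩
      rcases this with h | h
      · rw [h] at hW
        exact disjoint_left.1 hdisj hx hW
      · exact hBW x hx _ hW h.symm
    · intro x _ y _ h
      exact e'.symm.injective (Fin.ext h)
  · rintro ⟨hw, hb⟩
    obtain ⟨C, hC, hcard, hgain⟩ := exists_gain_eq_best (orderedMatrix G f g) (range n) n (n - w)
    rw [← hgain, gain] at hb
    have hB : b ≤
        #({x | ∀ i : Fin n, (e i = x ∨ G.Adj (e i) x) → (i : ℕ) ∈ C} : Finset (Fin n)) := by
      refine hb.trans (card_le_card_of_surjOn (fun x => (e'.symm x : ℕ)) ?_)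
      intro j hj
      simp only [coe_filter, Set.mem_ofPred_eq, mem_range] at hj
      refine ⟨e' ⟨j, hj.1⟩, ?_, by simp⟩
      simp only [coe_filter, mem_univ, true_and, Set.mem_ofPred_eq]
      exact fun i hi => hj.2.2 i i.2 ((hM i ⟨j, hj.1⟩).2 hi)
    have hW : w ≤ #({x | (e.symm x : ℕ) ∉ C} : Finset (Fin n)) := by
      have h1 : #({x | (e.symm x : ℕ) ∈ C} : Finset (Fin n)) ≤ #C :=
        card_le_card_of_injOn (fun x => (e.symm x : ℕ)) (fun x hx => by simpa using hx)
          (fun x _ y _ h => e.symm.injective (Fin.ext h))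
      have h2 := card_filter_add_card_filter_not (s := (univ : Finset (Fin n)))
        (fun x => (e.symm x : ℕ) ∈ C)
      rw [card_univ, Fintype.card_fin] at h2
      omega
    obtain ⟨B, hBs, hBc⟩ := exists_subset_card_eq hB
    obtain ⟨W, hWs, hWc⟩ := exists_subset_card_eq hW
    have hB' : ∀ x ∈ B, ∀ y ∈ W, ¬ (y = x ∨ G.Adj y x) := by
      intro x hx y hy h
      have h1 := hBs hx
      have h2 := hWs hy
      simp only [mem_filter, mem_univ, true_and] at h1 h2
      exact h2 (h1 (e.symm y) (by simpa using h))
    refine ⟨B, W, disjoint_left.2 fun x hx hx' => hB' x hx x hx' (Or.inl rfl), hBc, hWc,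
      fun x hx y hy h => hB' x hx y hy (Or.inr h.symm)⟩

end BW

/-! ### Programming in the bounded language -/

namespace BW

open Finset

/-- A term, read as a formula, holds if its value is not zero. -/
def Term.Holds (n : ℕ) (A : ℕ → ℕ → ℕ) (ρ : ℕ → ℕ) (e : Term) : Prop := e.eval n A ρ ≠ 0

namespace Term

/-- Conjunction. -/
def and (e f : Term) : Term := .ite e f (.const 0)
/-- Disjunction. -/
def or (e f : Term) : Term := .ite e (.const 1) f
/-- Negation. -/
def not (e : Term) : Term := .ite e (.const 0) (.const 1)
/-- Implication. -/
def imp (e f : Term) : Term := .ite e f (.const 1)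
/-- Strict inequality. -/
def lt (e f : Term) : Term := .sub f e
/-- Equality. -/
def eq (e f : Term) : Term := .not (.add (.sub e f) (.sub f e))
/-- Bounded existential quantifier. -/
def ex (x : ℕ) (e : Term) : Term := .sum x e
/-- Bounded universal quantifier. -/
def all (x : ℕ) (e : Term) : Term := .not (.ex x (.not e))
/-- Maximum. -/
def max (e f : Term) : Term := .add e (.sub f e)
/-- The number of values of a variable for which a formula holds. -/
def count (x : ℕ) (e : Term) : Term := .sum x (.ite e (.const 1) (.const 0))
/-- Address of the entry `(x, y)` in a table with rows of length `n`. -/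
def at2 (x y : Term) : Term := .add (.scale x) y
/-- Address of the entry `(x, y, z)` in a table. -/
def at3 (x y z : Term) : Term := .at2 (.at2 x y) z

variable {n : ℕ} {A : ℕ → ℕ → ℕ} {ρ : ℕ → ℕ} {e f c : Term} {x : ℕ}

theorem eval_ite [Decidable (c.Holds n A ρ)] :
    (Term.ite c e f).eval n A ρ = if c.Holds n A ρ then e.eval n A ρ else f.eval n A ρ := by
  simp only [eval, Holds]
  congr

theorem holds_get {a : ℕ} : (Term.get a e).Holds n A ρ ↔ A a (e.eval n A ρ) ≠ 0 := Iff.rfl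

theorem holds_const_one : (Term.const 1).Holds n A ρ := one_ne_zero

theorem holds_and : (e.and f).Holds n A ρ ↔ e.Holds n A ρ ∧ f.Holds n A ρ := by
  simp [and, Holds, eval]

theorem holds_or : (e.or f).Holds n A ρ ↔ e.Holds n A ρ ∨ f.Holds n A ρ := by
  simp only [or, Holds, eval]
  split_ifs with h <;> simp [h]

theorem holds_not : e.not.Holds n A ρ ↔ ¬ e.Holds n A ρ := by
  simp [not, Holds, eval]

theorem holds_imp : (e.imp f).Holds n A ρ ↔ (e.Holds n A ρ → f.Holds n A ρ) := by
  simp only [imp, Holds, eval]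
  split_ifs with h <;> simp [h]

theorem holds_lt : (e.lt f).Holds n A ρ ↔ e.eval n A ρ < f.eval n A ρ := by
  simp only [lt, Holds, eval]
  omega

theorem holds_eq : (e.eq f).Holds n A ρ ↔ e.eval n A ρ = f.eval n A ρ := by
  rw [eq, holds_not]
  simp only [Holds, eval]
  omega

theorem holds_ex : (Term.ex x e).Holds n A ρ ↔ ∃ v < n, e.Holds n A (Function.update ρ x v) := by
  simp [ex, Holds, eval, Finset.sum_eq_zero_iff]

theorem holds_all : (Term.all x e).Holds n A ρ ↔ ∀ v < n, e.Holds n A (Function.update ρ x v) := by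
  simp [all, holds_not, holds_ex]

theorem eval_max : (e.max f).eval n A ρ = Max.max (e.eval n A ρ) (f.eval n A ρ) := by
  simp only [max, eval]
  omega

open Classical in
theorem eval_count : (Term.count x e).eval n A ρ =
    #{v ∈ range n | e.Holds n A (Function.update ρ x v)} := by
  rw [count, eval, card_filter]
  exact sum_congr rfl fun v _ => by rw [eval_ite]; rfl

theorem eval_at2 : (e.at2 f).eval n A ρ = n * e.eval n A ρ + f.eval n A ρ := rfl

theorem eval_at3 : (c.at3 e f).eval n A ρ =
    n * (n * c.eval n A ρ + e.eval n A ρ) + f.eval n A ρ := rfl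

end Term

/-- Entries with different indices have different addresses. -/
theorem address_inj {n a b a' b' : ℕ} (hb : b < n) (hb' : b' < n) (h : n * a + b = n * a' + b') :
    a = a' ∧ b = b' := by
  have h1 : (n * a + b) / n = a := by
    rw [Nat.mul_add_div (by omega), Nat.div_eq_of_lt hb, add_zero]
  have h2 : (n * a' + b') / n = a' := by
    rw [Nat.mul_add_div (by omega), Nat.div_eq_of_lt hb', add_zero]
  have : a = a' := by rw [← h1, ← h2, h]
  subst this
  omega

/-- Loop invariants. -/
theorem Cmd.run_loop_of_invariant {n x : ℕ} {P : Cmd} {ρ : ℕ → ℕ} {A : ℕ → ℕ → ℕ}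
    (I : ℕ → (ℕ → ℕ → ℕ) → Prop) (h0 : I 0 A)
    (hI : ∀ m < n, ∀ A', I m A' → I (m + 1) (P.run n (Function.update ρ x m) A')) :
    I n ((Cmd.loop x P).run n ρ A) := by
  have : ∀ m ≤ n, I m (loopRun (P.run n) x ρ A m) := by
    intro m
    induction m with
    | zero => exact fun _ => h0
    | succ m ih => exact fun hm => hI m hm _ (ih (by omega))
  exact this n le_rfl

/-- The arrays that a command writes to. -/
def Cmd.targets : Cmd → List ℕ
  | .store a _ _ => [a]
  | .seq P Q => P.targets ++ Q.targets
  | .loop _ P => P.targets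

theorem Cmd.run_eq_of_notMem_targets {n : ℕ} (P : Cmd) (ρ : ℕ → ℕ) (A : ℕ → ℕ → ℕ) {a : ℕ}
    (ha : a ∉ P.targets) : P.run n ρ A a = A a := by
  induction P generalizing ρ A with
  | store b idx e =>
    simp only [targets, List.mem_singleton] at ha
    simp [run, ha]
  | seq P Q ihP ihQ =>
    simp only [targets, List.mem_append, not_or] at ha
    rw [run, ihQ _ _ ha.2, ihP _ _ ha.1]
  | loop x P ih =>
    exact run_loop_of_invariant (fun _ A' => A' a = A a) rfl
      fun m _ A' hA' => by rw [ih _ _ ha, hA']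

/-- A loop that fills the first `n` cells of an array, where the value of each cell may depend on
the previous ones. -/
theorem Cmd.run_loop_store {n x a : ℕ} {e : Term} {ρ : ℕ → ℕ} {A : ℕ → ℕ → ℕ} (f : ℕ → ℕ)
    (he : ∀ m < n, ∀ A' : ℕ → ℕ → ℕ, (∀ b ≠ a, A' b = A b) → (∀ m' < m, A' a m' = f m') →
      e.eval n A' (Function.update ρ x m) = f m) :
    ∀ m < n, (Cmd.loop x (.store a (.var x) e)).run n ρ A a m = f m := by
  have := run_loop_of_invariant (n := n) (x := x) (P := .store a (.var x) e) (ρ := ρ) (A := A)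
    (fun m A' => (∀ b ≠ a, A' b = A b) ∧ ∀ m' < m, A' a m' = f m')
    ⟨fun _ _ => rfl, fun m' h => absurd h (Nat.not_lt_zero _)⟩ ?_
  · exact this.2
  · rintro m hm A' ⟨h1, h2⟩
    refine ⟨fun b hb => ?_, fun m' hm' => ?_⟩
    · simp [run, hb, h1]
    · simp only [run, Function.update_self, Term.eval]
      rcases Nat.lt_succ_iff_lt_or_eq.1 hm' with h | rfl
      · rw [Function.update_of_ne h.ne, h2 m' h]
      · rw [Function.update_self, he m' hm A' h1 h2]

end BW

/-! ### Computing the ordered matrix and its forests -/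

namespace BW

open Finset Term

/-- Entry of the closed neighbourhood matrix; array 0 holds the adjacency matrix. -/
def nbTerm (u v : Term) : Term := (u.eq v).or (.get 0 (u.at2 v))

theorem holds_nbTerm {n : ℕ} {G : SimpleGraph (Fin n)} {A : ℕ → ℕ → ℕ} {b w : ℕ}
    (hA : A 0 = (inputState G b w).arr 0) {ρ : ℕ → ℕ} {u v : Term} (hv : v.eval n A ρ < n) :
    (nbTerm u v).Holds n A ρ ↔ Nb G (u.eval n A ρ) (v.eval n A ρ) := by
  rw [nbTerm, holds_or, holds_eq, holds_get, hA, Nb, eval_at2]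
  refine or_congr Iff.rfl ?_
  simp only [inputState, true_and, ne_eq, ite_eq_right_iff, one_ne_zero, imp_false, not_not]
  constructor
  · rintro ⟨i, j, h, hadj⟩
    obtain ⟨h1, h2⟩ := address_inj hv j.2 (h.trans (by rw [mul_comm]))
    exact ⟨i, j, h1.symm, h2.symm, hadj⟩
  · rintro ⟨i, j, h1, h2, hadj⟩
    exact ⟨i, j, by rw [h1, h2, mul_comm], hadj⟩

/-- Vertex `x` is not among the first rows, which are the entries of array 1; their number is
variable 2. -/
def unplacedTerm (x : ℕ) : Term :=
  .all 5 (.imp (.lt (.var 5) (.var 2)) (.not (.eq (.get 1 (.var 5)) (.var x))))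

/-- The relation `NextRow`. -/
def nextRowTerm (x : ℕ) : Term :=
  .and (unplacedTerm x) <| .all 6 <| .all 7 <|
    .imp (nbTerm (.var x) (.var 6)) <| .imp (nbTerm (.var x) (.var 7)) <|
    .or
      (.all 8 <| .imp (unplacedTerm 8) <|
        .imp (nbTerm (.var 8) (.var 6)) (nbTerm (.var 8) (.var 7)))
      (.all 8 <| .imp (unplacedTerm 8) <|
        .imp (nbTerm (.var 8) (.var 7)) (nbTerm (.var 8) (.var 6)))

theorem holds_unplacedTerm {n : ℕ} {A : ℕ → ℕ → ℕ} {ρ : ℕ → ℕ} {x : ℕ} (hx : x ≠ 5)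
    (hn : ρ 2 ≤ n) : (unplacedTerm x).Holds n A ρ ↔ ∀ i' < ρ 2, A 1 i' ≠ ρ x := by
  simp only [unplacedTerm, holds_all, holds_imp, holds_lt, holds_not, holds_eq, eval,
    Function.update_self, Function.update_of_ne hx, Function.update_of_ne (show 2 ≠ 5 by decide)]
  exact ⟨fun h i' hi' => h i' (by omega) hi', fun h i' _ hi' => h i' hi'⟩

theorem holds_nextRowTerm {n : ℕ} {G : SimpleGraph (Fin n)} {A : ℕ → ℕ → ℕ} {b w : ℕ}
    (hA : A 0 = (inputState G b w).arr 0) {ρ : ℕ → ℕ} {x : ℕ} (hx : x < 5)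
    (hn : ρ 2 ≤ n) : (nextRowTerm x).Holds n A ρ ↔ NextRow G (A 1) (ρ 2) (ρ x) := by
  rw [nextRowTerm, holds_and, holds_unplacedTerm (by omega) hn, NextRow]
  refine and_congr_right fun _ => ?_
  rw [holds_all]
  refine forall₂_congr fun u hu => ?_
  rw [holds_all]
  refine forall₂_congr fun u' hu' => ?_
  have h6 : x ≠ 6 := by omega
  have h7 : x ≠ 7 := by omega
  rw [holds_imp, holds_imp, holds_nbTerm hA (by simpa [eval] using hu),
    holds_nbTerm hA (by simpa [eval] using hu'), holds_or, holds_all, holds_all]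
  simp only [eval, Function.update_self, Function.update_of_ne h6, Function.update_of_ne h7,
    Function.update_of_ne (show 6 ≠ 7 by decide)]
  refine imp_congr_right fun _ => imp_congr_right fun _ => or_congr ?_ ?_
  all_goals
    refine forall₂_congr fun v hv => ?_
    rw [holds_imp, holds_imp, holds_unplacedTerm (by decide) (by simpa using hn),
      holds_nbTerm hA (by simp [eval, hu, hu']), holds_nbTerm hA (by simp [eval, hu, hu'])]
    simp [eval]

/-- The first vertex that is a possible next row. -/
def firstNextRowTerm : Term :=
  .sum 3 <|
    .ite (.and (nextRowTerm 3) (.all 4 (.imp (.lt (.var 4) (.var 3)) (.not (nextRowTerm 4)))))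
      (.var 3) (.const 0)

/-- Compute the order of the rows in array 1. -/
def rowsCmd : Cmd := .loop 2 (.store 1 (.var 2) firstNextRowTerm)

theorem NextRow.congr {n : ℕ} {G : SimpleGraph (Fin n)} {f f' : ℕ → ℕ} {i : ℕ}
    (h : ∀ i' < i, f i' = f' i') (v : ℕ) : NextRow G f i v ↔ NextRow G f' i v := by
  have : ∀ w, (∀ i' < i, f i' ≠ w) ↔ ∀ i' < i, f' i' ≠ w := fun w =>
    forall₂_congr fun i' hi' => by rw [h i' hi']
  simp only [NextRow, this]

theorem run_rowsCmd {n : ℕ} {G : SimpleGraph (Fin n)} (hG : IsStronglyChordal G)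
    {A : ℕ → ℕ → ℕ} {b w : ℕ} (hA : A 0 = (inputState G b w).arr 0) (ρ : ℕ → ℕ) :
    RowOrder G (rowsCmd.run n ρ A 1) n := by
  classical
  refine (Cmd.run_loop_of_invariant (fun m A' => A' 0 = A 0 ∧ RowOrder G (A' 1) m)
    ⟨rfl, fun i hi => absurd hi (Nat.not_lt_zero _)⟩ ?_).2
  rintro m hm A' ⟨h0, hrow⟩
  have hex := exists_nextRow hG (A' 1) hm
  obtain ⟨hlt, hnext⟩ := Nat.find_spec hex
  have hmin := fun v => Nat.find_min hex (m := v)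
  set v₀ := Nat.find hex
  have hval : firstNextRowTerm.eval n A' (Function.update ρ 2 m) = v₀ := by
    rw [firstNextRowTerm, eval]
    have hterm : ∀ v, (Term.and (nextRowTerm 3)
        (.all 4 (.imp (.lt (.var 4) (.var 3)) (.not (nextRowTerm 4))))).Holds n A'
          (Function.update (Function.update ρ 2 m) 3 v) ↔
        NextRow G (A' 1) m v ∧ ∀ v' < n, v' < v → ¬ NextRow G (A' 1) m v' := by
      intro v
      rw [holds_and, holds_nextRowTerm (h0.trans hA) (by decide) (by simpa using hm.le), holds_all]
      refine and_congr (by simp) (forall₂_congr fun v' _ => ?_)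
      rw [holds_imp, holds_not, holds_lt,
        holds_nextRowTerm (h0.trans hA) (by decide) (by simpa using hm.le)]
      simp [eval]
    rw [sum_eq_single v₀]
    · rw [eval_ite, if_pos]
      · simp [eval]
      · exact (hterm _).2 ⟨hnext, fun v' hv' hlt' h => hmin v' hlt' ⟨hv', h⟩⟩
    · intro v hv hne
      rw [eval_ite, if_neg]
      · simp [eval]
      · rw [hterm]
        rintro ⟨h1, h2⟩
        rw [mem_range] at hv
        rcases lt_or_gt_of_ne hne with h | h
        · exact hmin v h ⟨hv, h1⟩
        · exact h2 v₀ hlt h hnext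
    · exact fun h => absurd (mem_range.2 hlt) h
  have hrun : ∀ i, (Cmd.store 1 (.var 2) firstNextRowTerm).run n (Function.update ρ 2 m) A' 1 i =
      if i = m then v₀ else A' 1 i := by
    intro i
    rw [Cmd.run, hval, Function.update_self]
    simp [eval, Function.update_apply]
  refine ⟨by simpa [Cmd.run] using h0, fun i hi => ?_⟩
  have hc : ∀ i' < i,
      (Cmd.store 1 (.var 2) firstNextRowTerm).run n (Function.update ρ 2 m) A' 1 i' = A' 1 i' :=
    fun i' hi' => by rw [hrun, if_neg (by omega)]
  rw [NextRow.congr hc, hrun]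
  rcases Nat.lt_succ_iff_lt_or_eq.1 hi with h | rfl
  · rw [if_neg h.ne]
    exact hrow i h
  · rw [if_pos rfl]
    exact ⟨hlt, hnext⟩

/-- Compute the powers of two in array 2, each as one more than the sum of the previous ones. -/
def powersCmd : Cmd :=
  .loop 2 <| .store 2 (.var 2) <|
    .add (.const 1) (.sum 3 (.ite (.lt (.var 3) (.var 2)) (.get 2 (.var 3)) (.const 0)))

theorem run_powersCmd (n : ℕ) (A : ℕ → ℕ → ℕ) (ρ : ℕ → ℕ) {m : ℕ} (hm : m < n) :
    powersCmd.run n ρ A 2 m = 2 ^ m := by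
  classical
  refine Cmd.run_loop_store (fun m => 2 ^ m) (fun m hm A' _ h => ?_) m hm
  have : ∀ v ∈ range n, (Term.ite (.lt (.var 3) (.var 2)) (.get 2 (.var 3)) (.const 0)).eval n A'
      (Function.update (Function.update ρ 2 m) 3 v) = if v < m then 2 ^ v else 0 := by
    intro v _
    rw [eval_ite, holds_lt]
    simp only [eval, Function.update_self, Function.update_of_ne (show 2 ≠ 3 by decide)]
    split_ifs with hv
    · exact h v hv
    · rfl
  rw [eval, eval, eval, sum_congr rfl this, ← sum_filter]
  have hr : {v ∈ range n | v < m} = range m := by ext v; simp; omega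
  rw [hr, Nat.geomSum_eq le_rfl]
  have := Nat.one_le_two_pow (n := m)
  simp
  omega

/-- The binary number of a closed neighbourhood. -/
def keyTerm (x : ℕ) : Term :=
  .sum 5 (.ite (nbTerm (.get 1 (.var 5)) (.var x)) (.get 2 (.var 5)) (.const 0))

/-- The order of the columns. -/
def beforeTerm (x y : ℕ) : Term :=
  .or (.lt (keyTerm x) (keyTerm y)) (.and (.eq (keyTerm x) (keyTerm y)) (.lt (.var x) (.var y)))

/-- Compute the order of the columns in array 3. -/
def colsCmd : Cmd :=
  .loop 2 <| .store 3 (.var 2) <| .sum 3 <|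
    .ite (.eq (.count 4 (beforeTerm 4 3)) (.var 2)) (.var 3) (.const 0)

theorem eval_keyTerm {n : ℕ} {G : SimpleGraph (Fin n)} {A : ℕ → ℕ → ℕ} {b w : ℕ}
    (hA : A 0 = (inputState G b w).arr 0) (hpow : ∀ m < n, A 2 m = 2 ^ m) {ρ : ℕ → ℕ} {x : ℕ}
    (hx : x ≠ 5) (hn : ρ x < n) : (keyTerm x).eval n A ρ = key G (A 1) (ρ x) := by
  classical
  rw [keyTerm, eval, key]
  refine sum_congr rfl fun v hv => ?_
  rw [eval_ite, holds_nbTerm hA (by simpa [eval, hx] using hn)]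
  simp only [eval, Function.update_self, Function.update_of_ne hx]
  rw [hpow v (mem_range.1 hv)]

theorem run_colsCmd {n : ℕ} {G : SimpleGraph (Fin n)} {A : ℕ → ℕ → ℕ} {b w : ℕ}
    (hA : A 0 = (inputState G b w).arr 0) (hpow : ∀ m < n, A 2 m = 2 ^ m) (ρ : ℕ → ℕ) {m : ℕ}
    (hm : m < n) : colsCmd.run n ρ A 3 m = colAt n (key G (A 1)) m := by
  classical
  refine Cmd.run_loop_store _ (fun m hm A' h _ => ?_) m hm
  have h0 : A' 0 = (inputState G b w).arr 0 := (h 0 (by decide)).trans hA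
  have h2 : ∀ m < n, A' 2 m = 2 ^ m := by rw [h 2 (by decide)]; exact hpow
  rw [← h 1 (by decide), eval, colAt]
  refine sum_congr rfl fun u hu => ?_
  rw [mem_range] at hu
  rw [eval_ite, holds_eq, eval_count]
  have : ({v ∈ range n | (beforeTerm 4 3).Holds n A'
      (Function.update (Function.update (Function.update ρ 2 m) 3 u) 4 v)} : Finset ℕ) =
      ({v ∈ range n | Before (key G (A' 1)) v u} : Finset ℕ) := by
    refine filter_congr fun v hv => ?_
    rw [mem_range] at hv
    rw [beforeTerm, holds_or, holds_and, holds_lt, holds_eq, holds_lt,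
      eval_keyTerm h0 h2 (by decide) (by simpa using hv),
      eval_keyTerm h0 h2 (by decide) (by simpa using hu)]
    simp [eval, Before]
  rw [this]
  simp only [eval, rank, Function.update_self, Function.update_of_ne (show 2 ≠ 3 by decide)]
  congr

/-- Arrays 0, 1 and 3 describe the matrix `M`. -/
def HasMatrix (n : ℕ) (M : ℕ → ℕ → Prop) (A : ℕ → ℕ → ℕ) : Prop :=
  ∀ i < n, ∀ j < n, (A 1 i = A 3 j ∨ A 0 (n * A 1 i + A 3 j) ≠ 0) ↔ M i j

theorem HasMatrix.congr {n : ℕ} {M : ℕ → ℕ → Prop} {A A' : ℕ → ℕ → ℕ} (h : HasMatrix n M A)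
    (h0 : A' 0 = A 0) (h1 : A' 1 = A 1) (h3 : A' 3 = A 3) : HasMatrix n M A' := by
  intro i hi j hj
  rw [h0, h1, h3]
  exact h i hi j hj

/-- Entry of the reordered matrix. -/
def matTerm (i j : Term) : Term := nbTerm (.get 1 i) (.get 3 j)

theorem holds_matTerm {n : ℕ} {M : ℕ → ℕ → Prop} {A : ℕ → ℕ → ℕ} (hA : HasMatrix n M A)
    {ρ : ℕ → ℕ} {i j : Term} (hi : i.eval n A ρ < n) (hj : j.eval n A ρ < n) :
    (matTerm i j).Holds n A ρ ↔ M (i.eval n A ρ) (j.eval n A ρ) := by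
  rw [← hA _ hi _ hj, matTerm, nbTerm, holds_or, holds_eq, holds_get]
  rfl

/-- Two rows share one of the first `s` columns. -/
def shareTerm (s : Term) (i j : ℕ) : Term :=
  .ex 9 <| .and (.lt (.var 9) s) <| .and (matTerm (.var i) (.var 9)) (matTerm (.var j) (.var 9))

theorem holds_shareTerm {n : ℕ} {M : ℕ → ℕ → Prop} {A : ℕ → ℕ → ℕ} (hA : HasMatrix n M A)
    {ρ : ℕ → ℕ} {s : Term} {t i j : ℕ} (hs : ∀ v, s.eval n A (Function.update ρ 9 v) = t)
    (ht : t ≤ n) (hi : i ≠ 9) (hj : j ≠ 9) (hin : ρ i < n) (hjn : ρ j < n) :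
    (shareTerm s i j).Holds n A ρ ↔ Share M t (ρ i) (ρ j) := by
  rw [shareTerm, holds_ex, Share]
  have key : ∀ v < n, (Term.and (.lt (.var 9) s) (.and (matTerm (.var i) (.var 9))
      (matTerm (.var j) (.var 9)))).Holds n A (Function.update ρ 9 v) ↔
      v < t ∧ M (ρ i) v ∧ M (ρ j) v := by
    intro v hv
    rw [holds_and, holds_and, holds_lt, hs,
      holds_matTerm hA (by simpa [eval, hi] using hin) (by simpa [eval] using hv),
      holds_matTerm hA (by simpa [eval, hj] using hjn) (by simpa [eval] using hv)]
    simp [eval, hi, hj]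
  constructor
  · rintro ⟨v, hv, h⟩
    exact ⟨v, (key v hv).1 h⟩
  · rintro ⟨v, hv, h⟩
    exact ⟨v, by omega, (key v (by omega)).2 ⟨hv, h⟩⟩

/-- A loop that fills a table with three indices, where the value of each entry may depend on the
previous entries with the same first two indices. -/
theorem Cmd.run_loop_store_at3 {n x y z a : ℕ} (hxy : x ≠ y) (hxz : x ≠ z) (hyz : y ≠ z)
    {e : Term} {ρ : ℕ → ℕ} {A : ℕ → ℕ → ℕ} (good : ℕ → ℕ → ℕ → ℕ → Prop)
    (he : ∀ t < n, ∀ r < n, ∀ c < n, ∀ A' : ℕ → ℕ → ℕ, (∀ b ≠ a, A' b = A b) →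
      (∀ c' < c, good t r c' (A' a (n * (n * t + r) + c'))) →
      good t r c (e.eval n A' (Function.update (Function.update (Function.update ρ x t) y r) z c)))
    {t r c : ℕ} (ht : t < n) (hr : r < n) (hc : c < n) :
    good t r c ((Cmd.loop x <| .loop y <| .loop z <|
      .store a (.at3 (.var x) (.var y) (.var z)) e).run n ρ A a (n * (n * t + r) + c)) := by
  -- the entries filled before the one with indices `t`, `r`, `c`
  let I : ℕ → ℕ → ℕ → (ℕ → ℕ → ℕ) → Prop := fun t r c A' => (∀ b ≠ a, A' b = A b) ∧
    ∀ t' < n, ∀ r' < n, ∀ c' < n, (t' < t ∨ t' = t ∧ (r' < r ∨ r' = r ∧ c' < c)) →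
      good t' r' c' (A' a (n * (n * t' + r') + c'))
  have step : ∀ t < n, ∀ r < n, ∀ c < n, ∀ A', I t r c A' →
      I t r (c + 1) ((Cmd.store a (.at3 (.var x) (.var y) (.var z)) e).run n
        (Function.update (Function.update (Function.update ρ x t) y r) z c) A') := by
    rintro t ht r hr c hc A' ⟨h1, h2⟩
    refine ⟨fun b hb => by simp [Cmd.run, hb, h1], fun t' ht' r' hr' c' hc' hlt => ?_⟩
    simp only [Cmd.run, Function.update_self, eval_at3, eval,
      Function.update_of_ne hxy, Function.update_of_ne hxz, Function.update_of_ne hyz]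
    by_cases heq : n * (n * t' + r') + c' = n * (n * t + r) + c
    · obtain ⟨h3, h4⟩ := address_inj hc' hc heq
      obtain ⟨h5, h6⟩ := address_inj hr' hr h3
      subst h4 h5 h6
      rw [Function.update_self]
      exact he _ ht _ hr _ hc A' h1 fun c'' hc'' => h2 _ ht _ hr _ (by omega) (by omega)
    · rw [Function.update_of_ne heq]
      refine h2 t' ht' r' hr' c' hc' ?_
      have : ¬ (t' = t ∧ r' = r ∧ c' = c) := by
        rintro ⟨rfl, rfl, rfl⟩
        exact heq rfl
      omega
  have main : I n 0 0 ((Cmd.loop x <| .loop y <| .loop z <|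
      .store a (.at3 (.var x) (.var y) (.var z)) e).run n ρ A) := by
    refine run_loop_of_invariant (fun t => I t 0 0)
      ⟨fun _ _ => rfl, fun _ _ _ _ _ _ h => absurd h (by omega)⟩ fun t ht A₁ h₁ => ?_
    have h : I t n 0 ((Cmd.loop y <| .loop z <| .store a (.at3 (.var x) (.var y) (.var z)) e).run n
        (Function.update ρ x t) A₁) := by
      refine run_loop_of_invariant (fun r => I t r 0) h₁ fun r hr A₂ h₂ => ?_
      have h : I t r n ((Cmd.loop z <| .store a (.at3 (.var x) (.var y) (.var z)) e).run n
          (Function.update (Function.update ρ x t) y r) A₂) :=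
        run_loop_of_invariant (fun c => I t r c) h₂ fun c hc A₃ h₃ => step t ht r hr c hc A₃ h₃
      exact ⟨h.1, fun t' ht' r' hr' c' hc' hlt => h.2 t' ht' r' hr' c' hc' (by omega)⟩
    exact ⟨h.1, fun t' ht' r' hr' c' hc' hlt => h.2 t' ht' r' hr' c' hc' (by omega)⟩
  exact main.2 t ht r hr c hc (Or.inl ht)

/-- Compute the relations `Up M (t + 1)` in array 4. -/
def upCmd : Cmd :=
  .loop 2 <| .loop 3 <| .loop 4 <| .store 4 (.at3 (.var 2) (.var 3) (.var 4)) <|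
    .or (.eq (.var 3) (.var 4)) <| .ex 5 <| .and (.lt (.var 5) (.var 4)) <|
      .and (.get 4 (.at3 (.var 2) (.var 3) (.var 5))) (shareTerm (.add (.var 2) (.const 1)) 5 4)

theorem run_upCmd {n : ℕ} {M : ℕ → ℕ → Prop} {A : ℕ → ℕ → ℕ} (hA : HasMatrix n M A) (ρ : ℕ → ℕ)
    {t r c : ℕ} (ht : t < n) (hr : r < n) (hc : c < n) :
    upCmd.run n ρ A 4 (n * (n * t + r) + c) ≠ 0 ↔ Up M (t + 1) r c := by
  refine Cmd.run_loop_store_at3 (by decide) (by decide) (by decide)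
    (fun t r c v => v ≠ 0 ↔ Up M (t + 1) r c) (fun t ht r hr c hc A' hA' hprev => ?_) ht hr hc
  have hM : HasMatrix n M A' := hA.congr (hA' 0 (by decide)) (hA' 1 (by decide)) (hA' 3 (by decide))
  refine Iff.trans (b := r = c ∨ ∃ c' < n, c' < c ∧ Up M (t + 1) r c' ∧ Share M (t + 1) c' c) ?_ ?_
  · refine Iff.trans holds_or (or_congr ?_ ?_)
    · rw [holds_eq]
      simp [eval]
    · rw [holds_ex]
      refine exists_congr fun c' => and_congr_right fun hc' => ?_
      rw [holds_and, holds_and, holds_lt, holds_get,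
        holds_shareTerm (t := t + 1) hM (fun v => by simp [eval]) (by omega) (by decide) (by decide)
          (by simpa using hc') (by simpa using hc)]
      simp only [eval_at3]
      simp only [eval, Function.update_self, Function.update_of_ne (show 4 ≠ 5 by decide),
        Function.update_of_ne (show 3 ≠ 5 by decide), Function.update_of_ne (show 2 ≠ 5 by decide),
        Function.update_of_ne (show 3 ≠ 4 by decide), Function.update_of_ne (show 2 ≠ 4 by decide),
        Function.update_of_ne (show 2 ≠ 3 by decide)]
      exact and_congr_right fun h => and_congr_left fun _ => hprev c' h
  · constructor
    · rintro (rfl | ⟨c', -, hlt, h1, h2⟩)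
      · exact .refl
      · exact h1.tail ⟨hlt, h2⟩
    · intro h
      rcases Relation.ReflTransGen.cases_tail h with h | ⟨c', h1, h2⟩
      · exact Or.inl h.symm
      · exact Or.inr ⟨c', h2.1.trans hc, h2.1, h1, h2.2⟩

end BW

/-! ### Computing the tables -/

namespace BW

open Finset Term

/-- The row in variable `x` is a root of the set of rows described by `Z`; the number of columns in
question is `s`. -/
def rootTerm (Z : ℕ → Term) (s : Term) (x : ℕ) : Term :=
  .and (Z x) <| .all 8 <| .imp (Z 8) <| .imp (.lt (.var x) (.var 8)) <| .not (shareTerm s x 8)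

/-- The candidate for the next row of the convolution table `E`, for the split of variable 6 given
by variable 7. -/
def splitTerm (Z : ℕ → Term) (s : Term) (E : ℕ) : Term :=
  .ite (.lt (.var 7) (.add (.var 6) (.const 1)))
    (.add (.get E (.at2 (.var 5) (.var 7)))
      (.ite (rootTerm Z s 5) (.get 5 (.at3 s (.var 5) (.sub (.var 6) (.var 7)))) (.const 0)))
    (.const 0)

/-- Combine the entries of array 5 for the roots of the set of rows described by `Z`: row `i` of
the table in array `E` is for the part of `Z` below the roots less than `i`. Row 0 has to be zero in
advance. -/
def convCmd (Z : ℕ → Term) (s : Term) (E : ℕ) : Cmd :=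
  .loop 5 <| .loop 6 <| .store E (.at2 (.add (.var 5) (.const 1)) (.var 6)) <|
    .sup 7 (splitTerm Z s E)

/-- The formulas `ZT x` express that the value of variable `x` is in `Z`, whatever array `E` and
the variables from 5 on contain. -/
def Represents (n : ℕ) (ρ : ℕ → ℕ) (A : ℕ → ℕ → ℕ) (E : ℕ) (ZT : ℕ → Term) (Z : Finset ℕ) : Prop :=
  ∀ A' : ℕ → ℕ → ℕ, (∀ a ≠ E, A' a = A a) → ∀ ρ' : ℕ → ℕ, (∀ x < 5, ρ' x = ρ x) →
    ∀ x, ρ' x < n → ((ZT x).Holds n A' ρ' ↔ ρ' x ∈ Z)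

section conv

variable {n : ℕ} {M : ℕ → ℕ → Prop} {ρ : ℕ → ℕ} {A : ℕ → ℕ → ℕ} {E t : ℕ} {ZT : ℕ → Term}
  {Z : Finset ℕ} {s : Term}

theorem holds_rootTerm (hA : HasMatrix n M A) (h0 : E ≠ 0) (h1 : E ≠ 1) (h3 : E ≠ 3)
    (hs : ∀ (A' : ℕ → ℕ → ℕ) (ρ' : ℕ → ℕ), (∀ x < 5, ρ' x = ρ x) → s.eval n A' ρ' = t)
    (ht : t ≤ n) (hZn : Z ⊆ range n) (hrep : Represents n ρ A E ZT Z) {A' : ℕ → ℕ → ℕ}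
    (hA' : ∀ a ≠ E, A' a = A a) {ρ' : ℕ → ℕ} (hρ' : ∀ x < 5, ρ' x = ρ x) (hn : ρ' 5 < n) :
    (rootTerm ZT s 5).Holds n A' ρ' ↔ Root M Z t (ρ' 5) := by
  have hM : HasMatrix n M A' := hA.congr (hA' 0 h0.symm) (hA' 1 h1.symm) (hA' 3 h3.symm)
  rw [rootTerm, holds_and, hrep A' hA' ρ' hρ' 5 hn, Root, holds_all]
  refine and_congr_right fun _ => ?_
  have key : ∀ v < n,
      (Term.imp (ZT 8) (.imp (.lt (.var 5) (.var 8)) (.not (shareTerm s 5 8)))).Holds n A'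
        (Function.update ρ' 8 v) ↔ (v ∈ Z → ρ' 5 < v → ¬ Share M t (ρ' 5) v) := by
    intro v hv
    have hag : ∀ x < 5, Function.update ρ' 8 v x = ρ x := fun x hx => by
      rw [Function.update_of_ne (by omega), hρ' x hx]
    rw [holds_imp, holds_imp, holds_not, hrep A' hA' _ hag 8 (by simpa using hv), holds_lt,
      holds_shareTerm hM (fun u => hs A' _ fun x hx => by
        rw [Function.update_of_ne (by omega), hag x hx]) ht (by decide) (by decide)
        (by simpa using hn) (by simpa using hv)]
    simp [eval]
  constructor
  · intro h d hd
    have hdn := mem_range.1 (hZn hd)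
    exact (key d hdn).1 (h d hdn) hd
  · intro h v hv
    exact (key v hv).2 (h v)

theorem sup_range_ite_lt {y : ℕ} (hy : y < n) (f : ℕ → ℕ) :
    ((range n).sup fun v => if v < y + 1 then f v else 0) = (range (y + 1)).sup f := by
  apply le_antisymm
  · refine Finset.sup_le fun v _ => ?_
    split_ifs with h
    · exact le_sup (f := f) (mem_range.2 h)
    · exact Nat.zero_le _
  · refine Finset.sup_le fun v hv => ?_
    rw [mem_range] at hv
    refine le_trans ?_ (le_sup (f := fun v => if v < y + 1 then f v else 0)
      (mem_range.2 (show v < n by omega)))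
    simp [hv]

/-- The last row of the convolution table is that of all of `Z`. Row 0 is left zero, so that the
array can be used again. -/
theorem run_convCmd (hΓ : GammaFree M) (hA : HasMatrix n M A) (h0 : E ≠ 0) (h1 : E ≠ 1)
    (h3 : E ≠ 3) (h5 : E ≠ 5)
    (hs : ∀ (A' : ℕ → ℕ → ℕ) (ρ' : ℕ → ℕ), (∀ x < 5, ρ' x = ρ x) → s.eval n A' ρ' = t)
    (ht : t ≤ n) (hZn : Z ⊆ range n) (hZ : DownClosed M t Z) (hrep : Represents n ρ A E ZT Z)
    (hV : ∀ c < n, ∀ y < n, A 5 (n * (n * t + c) + y) = best M (below M n t c) t y)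
    (hE : ∀ y < n, A E y = 0) :
    (∀ y < n, (convCmd ZT s E).run n ρ A E (n * n + y) = best M Z t y) ∧
      ∀ y < n, (convCmd ZT s E).run n ρ A E y = 0 := by
  classical
  let I : ℕ → (ℕ → ℕ → ℕ) → Prop := fun i A' => (∀ a ≠ E, A' a = A a) ∧ (∀ y < n, A' E y = 0) ∧
    ∀ y < n, A' E (n * i + y) = best M (belowRoots M n Z t i) t y
  have main : I n ((convCmd ZT s E).run n ρ A) := by
    refine Cmd.run_loop_of_invariant I ⟨fun _ _ => rfl, hE, fun y hy => ?_⟩ fun i hi A₁ h₁ => ?_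
    · rw [belowRoots_zero, best_empty, mul_zero, zero_add, hE y hy]
    let J : ℕ → (ℕ → ℕ → ℕ) → Prop := fun y A' => I i A' ∧
      ∀ y' < y, A' E (n * (i + 1) + y') = best M (belowRoots M n Z t (i + 1)) t y'
    have inner := Cmd.run_loop_of_invariant (n := n) (x := 6)
      (P := .store E (.at2 (.add (.var 5) (.const 1)) (.var 6)) (.sup 7 (splitTerm ZT s E)))
      (ρ := Function.update ρ 5 i) (A := A₁) J ⟨h₁, fun y' h => absurd h (Nat.not_lt_zero _)⟩ ?_
    · exact ⟨inner.1.1, inner.1.2.1, inner.2⟩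
    rintro y hy A₂ ⟨⟨hag, hzero, hrow⟩, hprev⟩
    set ρ' := Function.update (Function.update ρ 5 i) 6 y with hρ'
    have hρ5 : ρ' 5 = i := by simp [hρ']
    have hρ6 : ρ' 6 = y := by simp [hρ']
    have hρlt : ∀ x < 5, ρ' x = ρ x := fun x hx => by
      rw [hρ', Function.update_of_ne (by omega), Function.update_of_ne (by omega)]
    have hval : (Term.sup 7 (splitTerm ZT s E)).eval n A₂ ρ' =
        best M (belowRoots M n Z t (i + 1)) t y := by
      rw [best_belowRoots_succ hΓ hZ, ← sup_range_ite_lt hy, eval]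
      refine sup_congr rfl fun v hv => ?_
      rw [mem_range] at hv
      have hlt : ∀ x < 5, Function.update ρ' 7 v x = ρ x := fun x hx => by
        rw [Function.update_of_ne (by omega), hρlt x hx]
      have h5' : Function.update ρ' 7 v 5 = i := by simp [hρ5]
      have h6' : Function.update ρ' 7 v 6 = y := by simp [hρ6]
      rw [splitTerm, eval_ite, holds_lt]
      refine ite_congr (by simp [eval, hρ6]) (fun hvy => ?_) fun _ => rfl
      rw [eval, eval_ite, holds_rootTerm hA h0 h1 h3 hs ht hZn hrep hag hlt (by rw [h5']; exact hi)]
      simp only [eval, eval_at2, eval_at3, h5', h6', hs A₂ _ hlt, Function.update_self]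
      rw [hrow v hv, hag 5 h5.symm, hV i hi (y - v) (by omega)]
    have hidx : (Term.at2 (.add (.var 5) (.const 1)) (.var 6)).eval n A₂ ρ' = n * (i + 1) + y := by
      simp [eval_at2, eval, hρ5, hρ6]
    have hrun : ∀ i' y', y' < n →
        (Cmd.store E (.at2 (.add (.var 5) (.const 1)) (.var 6)) (.sup 7 (splitTerm ZT s E))).run n
          ρ' A₂ E (n * i' + y') = if i' = i + 1 ∧ y' = y then
            best M (belowRoots M n Z t (i + 1)) t y else A₂ E (n * i' + y') := by
      intro i' y' hy'
      rw [Cmd.run, hval, hidx, Function.update_self, Function.update_apply]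
      refine if_congr ⟨fun h => address_inj hy' hy h, ?_⟩ rfl rfl
      rintro ⟨rfl, rfl⟩
      rfl
    refine ⟨⟨fun a ha => by simp [Cmd.run, ha, hag], fun y' hy' => ?_, fun y' hy' => ?_⟩,
      fun y' hy' => ?_⟩
    · have := hrun 0 y' hy'
      rw [mul_zero, zero_add, if_neg (by omega)] at this
      rw [this, hzero y' hy']
    · rw [hrun i y' hy', if_neg (by omega), hrow y' hy']
    · rw [hrun (i + 1) y' (by omega)]
      split_ifs with h
      · rw [h.2]
      · exact hprev y' (by omega)
  refine ⟨fun y hy => ?_, main.2.1⟩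
  rw [main.2.2 y hy, belowRoots_self hZn hZ]

end conv

/-- The row in variable `x` is below the row in variable 3, with respect to one column more than
the number in variable 2. -/
def belowTerm (x : ℕ) : Term := .get 4 (.at3 (.var 2) (.var x) (.var 3))

/-- The rows of `belowTerm` that are not in the column in variable 2. -/
def belowRestTerm (x : ℕ) : Term := .and (belowTerm x) (.not (matTerm (.var x) (.var 2)))

/-- The number of rows of `belowTerm` in the column in variable 2. -/
def costTerm : Term := .count 6 (.and (belowTerm 6) (matTerm (.var 6) (.var 2)))

/-- The row in variable `x` is the first row of the column in variable `y`. -/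
def firstTerm (x y : ℕ) : Term :=
  .and (matTerm (.var x) (.var y)) <| .all 8 <|
    .imp (.lt (.var 8) (.var x)) (.not (matTerm (.var 8) (.var y)))

/-- The number of columns that are complete once all rows counted by `costTerm` are taken. -/
def freeTerm : Term :=
  .count 6 <| .and (.lt (.var 6) (.add (.var 2) (.const 1))) <| .ex 7 <|
    .and (belowTerm 7) (.and (matTerm (.var 7) (.var 2)) (firstTerm 7 6))

/-- The recursion of `best_succ`. -/
def levelTerm : Term :=
  .max (.get 6 (.at2 .size (.var 5))) <|
    .ite (.lt costTerm (.add (.var 5) (.const 1)))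
      (.add freeTerm (.get 7 (.at2 .size (.sub (.var 5) costTerm)))) (.const 0)

/-- Compute the values `best M (below M n t c) t y` in array 5, for `t` from 0 to the input size;
those for `t = 0` are zero. -/
def levelsCmd : Cmd :=
  .loop 2 <| .loop 3 <| .seq (convCmd belowTerm (.var 2) 6) <|
    .seq (convCmd belowRestTerm (.var 2) 7) <|
      .loop 5 <| .store 5 (.at3 (.add (.var 2) (.const 1)) (.var 3) (.var 5)) levelTerm

section levels

variable {n : ℕ} {M : ℕ → ℕ → Prop} {ρ : ℕ → ℕ} {A : ℕ → ℕ → ℕ}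

/-- Array 4 describes the forests `Up M t`. -/
def HasUp (n : ℕ) (M : ℕ → ℕ → Prop) (A : ℕ → ℕ → ℕ) : Prop :=
  ∀ t < n, ∀ r < n, ∀ c < n, A 4 (n * (n * t + r) + c) ≠ 0 ↔ Up M (t + 1) r c

theorem holds_belowTerm (hA : HasUp n M A) {x : ℕ} (h2 : ρ 2 < n) (h3 : ρ 3 < n) (hx : ρ x < n) :
    (belowTerm x).Holds n A ρ ↔ ρ x ∈ below M n (ρ 2 + 1) (ρ 3) := by
  classical
  rw [belowTerm, holds_get, eval_at3]
  simp only [eval]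
  rw [hA _ h2 _ hx _ h3, below, mem_filter, mem_range]
  simp [hx]

open Classical in
theorem holds_belowRestTerm (hM : HasMatrix n M A) (hA : HasUp n M A) {x : ℕ} (h2 : ρ 2 < n)
    (h3 : ρ 3 < n) (hx : ρ x < n) : (belowRestTerm x).Holds n A ρ ↔
      ρ x ∈ ({r ∈ below M n (ρ 2 + 1) (ρ 3) | ¬ M r (ρ 2)} : Finset ℕ) := by
  rw [belowRestTerm, holds_and, holds_belowTerm hA h2 h3 hx, holds_not,
    holds_matTerm hM (i := .var x) (j := .var 2) hx h2, mem_filter]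
  rfl

open Classical in
theorem eval_costTerm (hM : HasMatrix n M A) (hA : HasUp n M A) (h2 : ρ 2 < n) (h3 : ρ 3 < n) :
    costTerm.eval n A ρ = #{r ∈ below M n (ρ 2 + 1) (ρ 3) | M r (ρ 2)} := by
  rw [costTerm, eval_count]
  congr 1
  ext v
  simp only [mem_filter, mem_range]
  constructor
  · rintro ⟨hv, h⟩
    rw [holds_and, holds_belowTerm hA (by simpa using h2) (by simpa using h3) (by simpa using hv),
      holds_matTerm hM (by simpa [eval] using hv) (by simpa [eval] using h2)] at h
    simpa [eval] using h
  · rintro ⟨hv, h⟩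
    have hvn : v < n := mem_range.1 (filter_subset _ _ hv)
    refine ⟨hvn, ?_⟩
    rw [holds_and, holds_belowTerm hA (by simpa using h2) (by simpa using h3) (by simpa using hvn),
      holds_matTerm hM (by simpa [eval] using hvn) (by simpa [eval] using h2)]
    simpa [eval] using ⟨hv, h⟩

theorem holds_firstTerm (hM : HasMatrix n M A) {x y : ℕ} (hx : ρ x < n) (hy : ρ y < n)
    (hx8 : x ≠ 8) (hy8 : y ≠ 8) : (firstTerm x y).Holds n A ρ ↔ First M (ρ x) (ρ y) := by
  rw [firstTerm, holds_and, holds_matTerm hM (i := .var x) (j := .var y) hx hy, holds_all, First]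
  refine and_congr_right fun _ => ?_
  have key : ∀ v < n,
      (Term.imp (.lt (.var 8) (.var x)) (.not (matTerm (.var 8) (.var y)))).Holds n A
      (Function.update ρ 8 v) ↔ (v < ρ x → ¬ M v (ρ y)) := by
    intro v hv
    rw [holds_imp, holds_not, holds_lt,
      holds_matTerm hM (by simpa [eval] using hv) (by simpa [eval, hy8] using hy)]
    simp [eval, hx8, hy8]
  exact ⟨fun h v hv => (key v (by omega)).1 (h v (by omega)) hv,
    fun h v hv => (key v hv).2 (h v)⟩

open Classical in
theorem eval_freeTerm (hM : HasMatrix n M A) (hA : HasUp n M A) (h2 : ρ 2 < n) (h3 : ρ 3 < n) :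
    freeTerm.eval n A ρ = #{j ∈ range (ρ 2 + 1) |
      ∃ r ∈ below M n (ρ 2 + 1) (ρ 3), M r (ρ 2) ∧ First M r j} := by
  rw [freeTerm, eval_count]
  congr 1
  ext j
  simp only [mem_filter, mem_range]
  rw [← and_iff_right_of_imp (a := j < n) (b := j < ρ 2 + 1 ∧ _) fun h => by omega]
  refine and_congr_right fun hj => ?_
  rw [holds_and, holds_lt, holds_ex]
  refine and_congr (by simp [eval]) ?_
  have key : ∀ r < n, (Term.and (belowTerm 7) (.and (matTerm (.var 7) (.var 2))
      (firstTerm 7 6))).Holds n A (Function.update (Function.update ρ 6 j) 7 r) ↔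
      r ∈ below M n (ρ 2 + 1) (ρ 3) ∧ M r (ρ 2) ∧ First M r j := by
    intro r hr
    rw [holds_and, holds_and,
      holds_belowTerm hA (by simpa using h2) (by simpa using h3) (by simpa using hr),
      holds_matTerm hM (by simpa [eval] using hr) (by simpa [eval] using h2),
      holds_firstTerm hM (by simpa using hr) (by simpa using hj) (by decide) (by decide)]
    simp [eval]
  constructor
  · rintro ⟨r, hr, h⟩
    exact ⟨r, (key r hr).1 h⟩
  · rintro ⟨r, hr, h⟩
    have hrn : r < n := mem_range.1 (filter_subset _ _ hr)
    exact ⟨r, hrn, (key r hrn).2 ⟨hr, h⟩⟩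

/-- The entries of array 5 before the one with indices `t`, `c`, `y` are right. -/
def Filled (n : ℕ) (M : ℕ → ℕ → Prop) (t c y : ℕ) (A : ℕ → ℕ → ℕ) : Prop :=
  ∀ t' c' y', c' < n → y' < n → (t' < t ∨ t' = t ∧ (c' < c ∨ c' = c ∧ y' < y)) →
    A 5 (n * (n * t' + c') + y') = best M (below M n t' c') t' y'

theorem eval_levelTerm (hΓ : GammaFree M) (hM : HasMatrix n M A) (hA : HasUp n M A) (h2 : ρ 2 < n)
    (h3 : ρ 3 < n) (h5 : ρ 5 < n)
    (h6 : ∀ y < n, A 6 (n * n + y) = best M (below M n (ρ 2 + 1) (ρ 3)) (ρ 2) y)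
    (h7 : open Classical in ∀ y < n, A 7 (n * n + y) =
      best M {r ∈ below M n (ρ 2 + 1) (ρ 3) | ¬ M r (ρ 2)} (ρ 2) y) :
    levelTerm.eval n A ρ = best M (below M n (ρ 2 + 1) (ρ 3)) (ρ 2 + 1) (ρ 5) := by
  classical
  rw [levelTerm, eval_max, best_succ hΓ, eval_ite, holds_lt]
  simp only [eval, eval_at2, eval_costTerm hM hA h2 h3, eval_freeTerm hM hA h2 h3]
  rw [h6 _ h5, h7 _ (by omega)]
  simp only [Nat.lt_succ_iff]

theorem run_levelsCmd (hΓ : GammaFree M) (hM : HasMatrix n M A) (hA : HasUp n M A)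
    (h5 : ∀ m, A 5 m = 0) (h6 : ∀ m, A 6 m = 0) (h7 : ∀ m, A 7 m = 0) {c y : ℕ} (hc : c < n)
    (hy : y < n) :
    levelsCmd.run n ρ A 5 (n * (n * n + c) + y) = best M (below M n n c) n y := by
  classical
  let I : ℕ → ℕ → ℕ → (ℕ → ℕ → ℕ) → Prop := fun t c y A' => (∀ a < 5, A' a = A a) ∧
    (∀ y < n, A' 6 y = 0) ∧ (∀ y < n, A' 7 y = 0) ∧ Filled n M t c y A'
  have main : I (n + 1) 0 0 (levelsCmd.run n ρ A) := by
    refine Cmd.run_loop_of_invariant (fun t => I (t + 1) 0 0) ⟨fun _ _ => rfl, fun _ _ => h6 _,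
      fun _ _ => h7 _, fun t c y hc hy h => ?_⟩ fun t ht A₁ h₁ => ?_
    · obtain rfl : t = 0 := by omega
      rw [h5, best_zero]
    have h : I (t + 1) n 0 ((Cmd.loop 3 <| .seq (convCmd belowTerm (.var 2) 6) <|
        .seq (convCmd belowRestTerm (.var 2) 7) <| .loop 5 <|
          .store 5 (.at3 (.add (.var 2) (.const 1)) (.var 3) (.var 5)) levelTerm).run n
        (Function.update ρ 2 t) A₁) := by
      refine Cmd.run_loop_of_invariant (fun c => I (t + 1) c 0) h₁ fun c hc A₂ h₂ => ?_
      obtain ⟨hag, h6, h7, hfill⟩ := h₂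
      set ρ' := Function.update (Function.update ρ 2 t) 3 c with hρ'
      have hρ2 : ρ' 2 = t := by simp [hρ']
      have hρ3 : ρ' 3 = c := by simp [hρ']
      have hM₂ : HasMatrix n M A₂ := hM.congr (hag 0 (by decide)) (hag 1 (by decide))
        (hag 3 (by decide))
      have hU₂ : HasUp n M A₂ := by rw [HasUp, hag 4 (by decide)]; exact hA
      have hs : ∀ (A' : ℕ → ℕ → ℕ) (ρ'' : ℕ → ℕ), (∀ x < 5, ρ'' x = ρ' x) →
          (Term.var 2).eval n A' ρ'' = t := fun A' ρ'' h => by rw [eval, h 2 (by decide), hρ2]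
      have hsub : below M n (t + 1) c ⊆ range n := filter_subset _ _
      have hdown : DownClosed M t (below M n (t + 1) c) := downClosed_below n c
      rw [Cmd.run, Cmd.run]
      -- the two convolution tables
      obtain ⟨hc6, hz6⟩ := run_convCmd (E := 6) (ZT := belowTerm) hΓ hM₂ (by decide) (by decide)
        (by decide) (by decide) hs ht.le hsub hdown
        (fun A' hA' ρ'' hρ'' x hx => by
          have hU' : HasUp n M A' := by rw [HasUp, hA' 4 (by decide)]; exact hU₂
          rw [holds_belowTerm hU' (by rw [hρ'' 2 (by decide), hρ2]; exact ht)
            (by rw [hρ'' 3 (by decide), hρ3]; exact hc) hx, hρ'' 2 (by decide),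
            hρ'' 3 (by decide), hρ2, hρ3])
        (fun c hc y hy => hfill t c y hc hy (by omega)) h6
      set A₃ := (convCmd belowTerm (.var 2) 6).run n ρ' A₂ with hA₃
      have h32 : ∀ a ≠ 6, A₃ a = A₂ a := fun a ha =>
        Cmd.run_eq_of_notMem_targets _ _ _ (by simpa [convCmd, Cmd.targets] using ha)
      have hM₃ : HasMatrix n M A₃ := hM₂.congr (h32 0 (by decide)) (h32 1 (by decide))
        (h32 3 (by decide))
      have hU₃ : HasUp n M A₃ := by rw [HasUp, h32 4 (by decide)]; exact hU₂
      obtain ⟨hc7, hz7⟩ := run_convCmd (E := 7) (ZT := belowRestTerm) hΓ hM₃ (by decide) (by decide)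
        (by decide) (by decide) hs ht.le ((filter_subset _ _).trans hsub) (hdown.filter hΓ)
        (fun A' hA' ρ'' hρ'' x hx => by
          have hU' : HasUp n M A' := by rw [HasUp, hA' 4 (by decide)]; exact hU₃
          have hM' : HasMatrix n M A' := hM₃.congr (hA' 0 (by decide)) (hA' 1 (by decide))
            (hA' 3 (by decide))
          rw [holds_belowRestTerm hM' hU' (by rw [hρ'' 2 (by decide), hρ2]; exact ht)
            (by rw [hρ'' 3 (by decide), hρ3]; exact hc) hx, hρ'' 2 (by decide),
            hρ'' 3 (by decide), hρ2, hρ3])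
        (fun c hc y hy => by rw [h32 5 (by decide)]; exact hfill t c y hc hy (by omega))
        (fun y hy => by rw [h32 7 (by decide)]; exact h7 y hy)
      set A₄ := (convCmd belowRestTerm (.var 2) 7).run n ρ' A₃ with hA₄
      have h43 : ∀ a ≠ 7, A₄ a = A₃ a := fun a ha =>
        Cmd.run_eq_of_notMem_targets _ _ _ (by simpa [convCmd, Cmd.targets] using ha)
      -- the new row of array 5
      let J : ℕ → (ℕ → ℕ → ℕ) → Prop := fun y A' =>
        (∀ a ≠ 5, A' a = A₄ a) ∧ Filled n M (t + 1) c y A'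
      have hJ := Cmd.run_loop_of_invariant (n := n) (x := 5)
        (P := .store 5 (.at3 (.add (.var 2) (.const 1)) (.var 3) (.var 5)) levelTerm)
        (ρ := ρ') (A := A₄) J ⟨fun _ _ => rfl, fun t' c' y' h1 h2 h3 => by
          rw [h43 5 (by decide), h32 5 (by decide)]; exact hfill t' c' y' h1 h2 h3⟩ ?_
      · obtain ⟨hag', hfill'⟩ := hJ
        refine ⟨fun a ha => ?_, fun y hy => ?_, fun y hy => ?_, fun t' c' y' h1 h2 h3 =>
          hfill' t' c' y' h1 h2 (by omega)⟩
        · rw [hag' a (by omega), h43 a (by omega), h32 a (by omega), hag a ha]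
        · rw [hag' 6 (by decide), h43 6 (by decide)]
          exact hz6 y hy
        · rw [hag' 7 (by decide)]
          exact hz7 y hy
      rintro y hy A₅ ⟨h54, hfill₅⟩
      have h5 : ∀ a < 5, A₅ a = A₂ a := fun a ha => by
        rw [h54 a (by omega), h43 a (by omega), h32 a (by omega)]
      have hM₅ : HasMatrix n M A₅ := hM₂.congr (h5 0 (by decide)) (h5 1 (by decide))
        (h5 3 (by decide))
      have hU₅ : HasUp n M A₅ := by rw [HasUp, h5 4 (by decide)]; exact hU₂
      have e2 : Function.update ρ' 5 y 2 = t := by simp [hρ2]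
      have e3 : Function.update ρ' 5 y 3 = c := by simp [hρ3]
      have e5 : Function.update ρ' 5 y 5 = y := by simp
      have hval : levelTerm.eval n A₅ (Function.update ρ' 5 y) =
          best M (below M n (t + 1) c) (t + 1) y := by
        rw [eval_levelTerm hΓ hM₅ hU₅ (by rw [e2]; exact ht) (by rw [e3]; exact hc)
          (by rw [e5]; exact hy), e2, e3, e5]
        · intro y hy
          rw [e2, e3, h54 6 (by decide), h43 6 (by decide)]
          exact hc6 y hy
        · intro y hy
          rw [e2, e3, h54 7 (by decide)]
          exact hc7 y hy
      refine ⟨fun a ha => by simp [Cmd.run, ha, h54], fun t' c' y' h1 h2 h3 => ?_⟩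
      rw [Cmd.run, hval, Function.update_self, eval_at3]
      simp only [eval, e2, e3, e5]
      by_cases heq : n * (n * t' + c') + y' = n * (n * (t + 1) + c) + y
      · obtain ⟨h4, h5⟩ := address_inj h2 hy heq
        obtain ⟨h6, h7⟩ := address_inj h1 hc h4
        subst h5 h6 h7
        rw [Function.update_self]
      · rw [Function.update_of_ne heq]
        refine hfill₅ t' c' y' h1 h2 ?_
        have : ¬ (t' = t + 1 ∧ c' = c ∧ y' = y) := by
          rintro ⟨rfl, rfl, rfl⟩
          exact heq rfl
        omega
    exact ⟨h.1, h.2.1, h.2.2.1, fun t' c' y' h1 h2 h3 => h.2.2.2 t' c' y' h1 h2 (by omega)⟩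
  exact main.2.2.2 n c y hc hy (by omega)

end levels

end BW

/-! ### The algorithm -/

namespace BW

open Finset Term

/-- Compute the values of `best` for the set of all rows and all columns, in row `n` of array 8. The
other arrays are: 0 the input, 1 the rows, 2 the powers of two, 3 the columns, 4 the forests, 5 the
values for the trees of all forests, 6 and 7 convolution tables. -/
def solveCmd : Cmd :=
  .seq rowsCmd <| .seq powersCmd <| .seq colsCmd <| .seq upCmd <| .seq levelsCmd <|
    convCmd (fun _ => .const 1) .size 8

/-- The answer, from variables 0 and 1 for the numbers of white and of black vertices. The case
without white vertices is separate since a row of array 8 ends at `n - 1`. -/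
def answerTerm : Term :=
  .ite (.ite (.var 0)
      (.and (.lt (.var 0) (.add .size (.const 1)))
        (.lt (.var 1) (.add (.get 8 (.at2 .size (.sub .size (.var 0)))) (.const 1))))
      (.lt (.var 1) (.add .size (.const 1))))
    (.const 1) (.const 0)

theorem RowOrder.injective {n : ℕ} {G : SimpleGraph (Fin n)} {f : ℕ → ℕ} (hf : RowOrder G f n) :
    ∀ i < n, ∀ i' < i, f i' ≠ f i := fun i hi => (hf i hi).2.1

theorem hasMatrix_orderedMatrix {n : ℕ} {G : SimpleGraph (Fin n)} {A : ℕ → ℕ → ℕ} {b w : ℕ}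
    (h0 : A 0 = (inputState G b w).arr 0) {g : ℕ → ℕ} (hg : ∀ j < n, g j < n)
    (h3 : ∀ j < n, A 3 j = g j) : HasMatrix n (orderedMatrix G (A 1) g) A := by
  intro i hi j hj
  have := holds_nbTerm h0 (ρ := fun _ => 0) (u := .const (A 1 i)) (v := .const (g j)) (hg j hj)
  rw [nbTerm, holds_or, holds_eq, holds_get] at this
  simp only [eval, eval_at2] at this
  rw [h3 j hj, this, orderedMatrix]
  simp [hi, hj]

/-- The final table is that of `best` for a doubly ordered neighbourhood matrix. -/
theorem run_solveCmd {n : ℕ} {G : SimpleGraph (Fin n)} (hG : IsStronglyChordal G) (b w : ℕ)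
    (ρ : ℕ → ℕ) : ∃ f : ℕ → ℕ, RowOrder G f n ∧ ∀ y < n,
      solveCmd.run n ρ (inputState G b w).arr 8 (n * n + y) =
        best (orderedMatrix G f (colAt n (key G f))) (range n) n y := by
  classical
  set A₀ := (inputState G b w).arr with hA₀
  have hzero : ∀ a ≠ 0, ∀ m, A₀ a m = 0 := fun a ha m => by simp [hA₀, inputState, ha]
  set A₁ := rowsCmd.run n ρ A₀ with hA₁
  have h1 : ∀ a ≠ 1, A₁ a = A₀ a := fun a ha =>
    Cmd.run_eq_of_notMem_targets _ _ _ (by simpa [rowsCmd, Cmd.targets] using ha)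
  have hrow : RowOrder G (A₁ 1) n := run_rowsCmd hG (b := b) (w := w) rfl ρ
  set A₂ := powersCmd.run n ρ A₁ with hA₂
  have h2 : ∀ a ≠ 2, A₂ a = A₁ a := fun a ha =>
    Cmd.run_eq_of_notMem_targets _ _ _ (by simpa [powersCmd, Cmd.targets] using ha)
  have hpow : ∀ m < n, A₂ 2 m = 2 ^ m := fun m hm => run_powersCmd n A₁ ρ hm
  set A₃ := colsCmd.run n ρ A₂ with hA₃
  have h3 : ∀ a ≠ 3, A₃ a = A₂ a := fun a ha =>
    Cmd.run_eq_of_notMem_targets _ _ _ (by simpa [colsCmd, Cmd.targets] using ha)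
  have h20 : A₂ 0 = A₀ 0 := (h2 0 (by decide)).trans (h1 0 (by decide))
  have h31 : A₃ 1 = A₁ 1 := (h3 1 (by decide)).trans (h2 1 (by decide))
  have hcol : ∀ m < n, A₃ 3 m = colAt n (key G (A₁ 1)) m := fun m hm => by
    rw [hA₃, run_colsCmd (b := b) (w := w) h20 hpow ρ hm, h2 1 (by decide)]
  have hΓ := gammaFree_orderedMatrix hrow
  set M := orderedMatrix G (A₁ 1) (colAt n (key G (A₁ 1))) with hM
  have hM₃ : HasMatrix n M A₃ := by
    have := hasMatrix_orderedMatrix (b := b) (w := w) ((h3 0 (by decide)).trans h20)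
      (fun j hj => (colAt_spec (key G (A₁ 1)) hj).1) hcol
    rwa [h31] at this
  set A₄ := upCmd.run n ρ A₃ with hA₄
  have h4 : ∀ a ≠ 4, A₄ a = A₃ a := fun a ha =>
    Cmd.run_eq_of_notMem_targets _ _ _ (by simpa [upCmd, Cmd.targets] using ha)
  have hM₄ : HasMatrix n M A₄ := hM₃.congr (h4 0 (by decide)) (h4 1 (by decide)) (h4 3 (by decide))
  have hU₄ : HasUp n M A₄ := fun t ht r hr c hc => run_upCmd hM₃ ρ ht hr hc
  have hz : ∀ a, 5 ≤ a → ∀ m, A₄ a m = 0 := fun a ha m => by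
    rw [h4 a (by omega), h3 a (by omega), h2 a (by omega), h1 a (by omega), hzero a (by omega)]
  set A₅ := levelsCmd.run n ρ A₄ with hA₅
  have h5 : ∀ a, a ≠ 5 ∧ a ≠ 6 ∧ a ≠ 7 → A₅ a = A₄ a := fun a ha =>
    Cmd.run_eq_of_notMem_targets _ _ _ (by simp [levelsCmd, convCmd, Cmd.targets]; omega)
  have hM₅ : HasMatrix n M A₅ := hM₄.congr (h5 0 (by decide)) (h5 1 (by decide)) (h5 3 (by decide))
  refine ⟨A₁ 1, hrow, ?_⟩
  exact (run_convCmd (E := 8) (ρ := ρ) (ZT := fun _ => .const 1) (Z := range n) (s := .size) hΓ hM₅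
    (by decide) (by decide) (by decide) (by decide) (fun _ _ _ => rfl) le_rfl Subset.rfl
    (fun r c hc hu => mem_range.2 (hu.le.trans_lt (mem_range.1 hc)))
    (fun A' _ ρ' _ x hx => iff_of_true holds_const_one (mem_range.2 hx))
    (fun c hc y hy => run_levelsCmd hΓ hM₄ hU₄ (hz 5 (by decide)) (hz 6 (by decide))
      (hz 7 (by decide)) hc hy)
    (fun y _ => by rw [h5 8 (by decide), hz 8 (by decide)])).1

theorem hasBWColoring_zero_right {n : ℕ} (G : SimpleGraph (Fin n)) (b : ℕ) :
    HasBWColoring G b 0 ↔ b ≤ n := by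
  constructor
  · rintro ⟨B, -, -, rfl, -⟩
    exact card_finset_fin_le B
  · intro h
    obtain ⟨B, -, hB⟩ := exists_subset_card_eq (s := (univ : Finset (Fin n))) (by simpa using h)
    exact ⟨B, ∅, disjoint_empty_right B, hB, rfl, by simp⟩

open Classical in
theorem eval_answerTerm {n : ℕ} {G : SimpleGraph (Fin n)} (hG : IsStronglyChordal G) (b w : ℕ)
    {ρ : ℕ → ℕ} (h0 : ρ 0 = w) (h1 : ρ 1 = b) :
    answerTerm.eval n (solveCmd.run n ρ (inputState G b w).arr) ρ =
      if HasBWColoring G b w then 1 else 0 := by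
  rw [answerTerm, eval_ite]
  refine if_congr ?_ rfl rfl
  obtain ⟨f, hf, hbest⟩ := run_solveCmd hG b w ρ
  rw [Holds, eval]
  split_ifs with hw
  · rw [eval, h0] at hw
    rw [hasBWColoring_iff (fun i hi => (hf i hi).1) hf.injective
      (fun j hj => (colAt_spec (key G f) hj).1) (fun j hj j' hj' h => ?_)]
    · refine holds_and.trans ?_
      rw [holds_lt, holds_lt]
      simp only [eval, eval_at2, h0, h1, Nat.lt_succ_iff]
      exact and_congr_right fun hwn => by rw [hbest _ (by omega)]
    · have := (colAt_spec (key G f) hj).2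
      rw [← h, (colAt_spec (key G f) (hj'.trans hj)).2] at this
      omega
  · rw [eval, h0, ne_eq, not_not] at hw
    subst hw
    rw [hasBWColoring_zero_right]
    refine holds_lt.trans ?_
    simp only [eval, h1, Nat.lt_succ_iff]

end BW

theorem mainTheorem7 :
    ∃ (P : BW.Program) (p : Polynomial ℕ),
      ∀ (n k : ℕ) (G : SimpleGraph (Fin n)),
        BW.IsStronglyChordal G → BW.IsKTree G k →
          ∀ b w : ℕ, BW.DecidesBWWithin P G b w (p.eval n) := by
  obtain ⟨Q, p, h⟩ := BW.exists_program BW.solveCmd BW.answerTerm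
  refine ⟨Q, p, fun n k G hG _ b w => ?_⟩
  obtain ⟨t, s', hexec, ht, ρ, h0, h1, hout⟩ := h (BW.inputState G b w)
  refine ⟨t, s', hexec, ht, hout.trans ?_⟩
  exact BW.eval_answerTerm hG b w h0 h1
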